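/- A controlled observability planning problem $P_{CO}=\langle\langle\mathcal F,\mathcal A,\mathcal I\rangle,\mathcal G,\Omega,\mathcal O\rangle$ consists of a finite set $\mathcal F$ of Boolean fluents (a state is an instantiation of all fluents; a set $g$ of instantiated fluents holds in a state $s$, written $s\models g$, if $s$ agrees with it), a finite set $\mathcal A$ of actions $a=\langle pre(a),add(a),delete(a),c(a)\rangle$ with $pre(a),add(a),delete(a)\subseteq\mathcal F$ and a cost $c(a)\in\mathbb N$, an initial state $\mathcal I$, a finite set $\mathcal G$ of candidate goals, each a set of instantiated fluents, with a distinguished true goal $G_A\in\mathcal G$, a finite set $\Omega$ of observations, and an observation function $\mathcal O$ which assigns an observation $\mathcal O(a,s')$ to every action $a$ and next state $s'$, and an observation $\mathcal O(\emptyset,s)$ to every state $s$ before any action is taken. In an input, each function $\mathcal O(a,\cdot)$, $\mathcal O(\emptyset,\cdot)$ is given as an ordered list of rules "if these instantiated fluents hold, emit this observation" with a default observation. The transition function is $\Gamma(s,a)=(s\cup add(a))\setminus delete(a)$ if all fluents of $pre(a)$ are true in $s$, and is undefined otherwise (states being identified with their sets of true fluents); it extends to action sequences. Let $\pi=\langle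 a_1,\dots,a_r\rangle$ be an action sequence that is executable from $s_0=\mathcal I$, through the states $s_1,\dots,s_r$. Its belief sequence is $b_0=\{\hat s\mid\mathcal O(\emptyset,\hat s)=\mathcal O(\emptyset,s_0)\}$ and $b_{i+1}=\{\hat s'\mid\exists \hat s\in b_i,\ \exists \hat a\in\mathcal A:\ \Gamma(\hat s,\hat a)=\hat s',\ \mathcal O(\hat a,\hat s')=\mathcal O(a_{i+1},s_{i+1})\}$. Write $|b_r\cap\mathcal G|$ for the number of goals $G\in\mathcal G$ that hold in at least one state of $b_r$. For $1\le k,j\le|\mathcal G|$, $\pi$ is a $k$-ambiguous plan if $s_r\models G_A$ and $|b_r\cap\mathcal G|\ge k$, and a $j$-legible plan if $s_r\models G_A$ and $|b_r\cap\mathcal G|\le j$. The plan existence problem for controlled observability planning is: given a controlled observability planning problem, the variant (goal obfuscation or goal legibility) and the bound ($k$ or $j$), decide whether there is a solution plan, i.e. a $k$-ambiguous plan (goal obfuscation) or a $j$-legible plan (goal legibility). **Theorem 1.** The plan existence problem for controlled observability planning is EXPSPACE-hard under polynomial-time many-one reductions. It is so already for $k=j=1$: it is EXPSPACE-hard to decide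 whether a given controlled observability planning problem has a plan that is both $1$-ambiguous and $1$-legible, i.e. a plan that reaches $G_A$ and has $|b_r\cap\mathcal G|=1$ for its last belief $b_r$. -/

import Mathlib

/-! ### Exponential space and polynomial-time many-one hardness

Both notions are over the multi-stack machines `Turing.FinTM2` of Mathlib (finite control,
finitely many stacks; an equivalent of the multi-tape Turing machine). -/

/-- The total number of stack cells in use in a configuration. -/
def cfgSpace (tm : Turing.FinTM2) (c : tm.Cfg) : ℕ :=
  letI := tm.kFin
  ∑ k : tm.K, (Turing.TM2.Cfg.stk c k).length

/-- The configuration `c` is reached by `tm` from the initial configuration on input `w`. -/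
def reachesFromInput (tm : Turing.FinTM2) (w : List (tm.Γ tm.k₀)) (c : tm.Cfg) : Prop :=
  Turing.TM2.Reaches tm.m (Turing.initList tm w) c

open Classical in
/-- The characteristic function of a language. -/
noncomputable def charFun (L : Set (List Bool)) (w : List Bool) : Bool := decide (w ∈ L)

/-- `EXPSPACE`: the languages decided by a deterministic machine (halting on every input with the
one-symbol output `true` or `false`) which on every input `w` uses at most `2 ^ p(|w|)` cells, for
some polynomial `p`. -/
def InEXPSPACE (L : Set (List Bool)) : Prop :=
  ∃ (M : Turing.TM2Computable (id : List Bool → List Bool) Computability.encodeBool (charFun L))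
    (p : Polynomial ℕ),
    ∀ (w : List Bool) (c : M.tm.Cfg),
      reachesFromInput M.tm (w.map M.inputAlphabet.invFun) c →
        cfgSpace M.tm c ≤ 2 ^ p.eval w.length

/-- Polynomial-time many-one reducibility of a language to a decision problem `Q` on the type `α`
of instances, the instances being written down as bit strings by `enc`. -/
def PolyTimeReduces {α : Type} (L : Set (List Bool)) (enc : α → List Bool) (Q : Set α) : Prop :=
  ∃ f : List Bool → α,
    Nonempty (Turing.TM2ComputableInPolyTime (id : List Bool → List Bool) enc f) ∧
      ∀ w, w ∈ L ↔ f w ∈ Q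

/-- `EXPSPACE`-hardness of a decision problem `Q` (under polynomial-time many-one reductions). -/
def EXPSPACEHard {α : Type} (enc : α → List Bool) (Q : Set α) : Prop :=
  ∀ L : Set (List Bool), InEXPSPACE L → PolyTimeReduces L enc Q

/-! ### Controlled observability planning problems -/

/-- A state: an instantiation of `n` fluents. -/
abbrev State (n : ℕ) : Type := Fin n → Bool

/-- A set of instantiated fluents (a conjunction of literals); `none` leaves the fluent free. -/
abbrev PartialState (n : ℕ) : Type := Fin n → Option Bool

/-- `s ⊨ g`. -/
def State.Sat {n : ℕ} (s : State n) (g : PartialState n) : Prop :=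
  ∀ i b, g i = some b → s i = b

instance {n : ℕ} (s : State n) (g : PartialState n) : Decidable (s.Sat g) :=
  inferInstanceAs (Decidable (∀ i b, g i = some b → s i = b))

/-- An action `⟨pre, add, delete, c⟩`. -/
structure PlanAction (n : ℕ) where
  pre : Finset (Fin n)
  add : Finset (Fin n)
  delete : Finset (Fin n)
  cost : ℕ

/-- The transition function: undefined (`none`) if the precondition fails,
and `(s ∪ add) \ delete` otherwise. -/
def PlanAction.apply {n : ℕ} (a : PlanAction n) (s : State n) : Option (State n) :=
  if ∀ i ∈ a.pre, s i = true then
    some fun i => (s i || decide (i ∈ a.add)) && !decide (i ∈ a.delete)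
  else none

/-- A map from states to `m` observations, written as an ordered list of rules
"if `g` holds, emit `o`" with a default observation (the first applicable rule decides).
Every map from states to `Fin m` can be written in this way. -/
structure Sensor (n m : ℕ) where
  rules : List (PartialState n × Fin m)
  default : Fin m

/-- The observation emitted in state `s`. -/
def Sensor.eval {n m : ℕ} (r : Sensor n m) (s : State n) : Fin m :=
  ((r.rules.find? fun x => decide (s.Sat x.1)).map Prod.snd).getD r.default

/-- A controlled observability planning problem `⟨⟨F, A, I⟩, 𝒢, Ω, O⟩`. -/
structure COProblem where
  /-- number of fluents -/
  nFluents : ℕ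
  /-- number of actions -/
  nActions : ℕ
  /-- number of observations -/
  nObs : ℕ
  /-- the actions -/
  action : Fin nActions → PlanAction nFluents
  /-- the initial state -/
  init : State nFluents
  /-- the true goal `G_A` -/
  trueGoal : PartialState nFluents
  /-- the other candidate goals -/
  otherGoals : List (PartialState nFluents)
  /-- the observation function before any action, `O(∅, ·)` -/
  initSensor : Sensor nFluents nObs
  /-- the observation function `O(a, ·)`, for the action just taken -/
  sensor : Fin nActions → Sensor nFluents nObs

namespace COProblem

/-- The observation function `O`, on pairs of an action (`none` for "no action yet") and the state
reached. -/
def obs (P : COProblem) (a : Option (Fin P.nActions)) (s : State P.nFluents) : Fin P.nObs :=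
  match a with
  | none => P.initSensor.eval s
  | some a => (P.sensor a).eval s

/-- The transition function `Γ(s, a)`. -/
def step (P : COProblem) (s : State P.nFluents) (a : Fin P.nActions) :
    Option (State P.nFluents) :=
  (P.action a).apply s

/-- `Γ(s, π)`, for a sequence of actions. -/
def run (P : COProblem) (s : State P.nFluents) : List (Fin P.nActions) → Option (State P.nFluents)
  | [] => some s
  | a :: π => (P.step s a).bind fun s' => P.run s' π

/-- The observations `o₁, o₂, …` emitted by the action sequence `π` executed from `s`
(up to the first action that is not applicable, if there is one). -/
def emitted (P : COProblem) (s : State P.nFluents) : List (Fin P.nActions) → List (Fin P.nObs)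
  | [] => []
  | a :: π =>
    match P.step s a with
    | none => []
    | some s' => P.obs (some a) s' :: P.emitted s' π

/-- The initial belief `b₀`: all states with the same initial observation as `s₀`. -/
def initBelief (P : COProblem) (s₀ : State P.nFluents) : Set (State P.nFluents) :=
  {s | P.obs none s = P.obs none s₀}

/-- The belief update. -/
def update (P : COProblem) (b : Set (State P.nFluents)) (o : Fin P.nObs) :
    Set (State P.nFluents) :=
  {s' | ∃ s ∈ b, ∃ a, P.step s a = some s' ∧ P.obs (some a) s' = o}

/-- The last belief of the belief sequence induced by `π` from the initial state. -/
def lastBelief (P : COProblem) (π : List (Fin P.nActions)) : Set (State P.nFluents) :=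
  (P.emitted P.init π).foldl P.update (P.initBelief P.init)

/-- The set `𝒢` of all candidate goals, the true goal included. -/
def goals (P : COProblem) : Finset (PartialState P.nFluents) :=
  insert P.trueGoal P.otherGoals.toFinset

/-- The candidate goals that hold in some state of the belief `b`, written `b ∩ 𝒢`. -/
def goalsIn (P : COProblem) (b : Set (State P.nFluents)) : Set (PartialState P.nFluents) :=
  {g | g ∈ P.goals ∧ ∃ s ∈ b, s.Sat g}

/-- The plan `π` is executable from the initial state and reaches the true goal. -/
def Reaches (P : COProblem) (π : List (Fin P.nActions)) : Prop :=
  ∃ s, P.run P.init π = some s ∧ s.Sat P.trueGoal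

/-- `π` is a `k`-ambiguous plan. -/
def IsAmbiguous (P : COProblem) (k : ℕ) (π : List (Fin P.nActions)) : Prop :=
  1 ≤ k ∧ k ≤ P.goals.card ∧ P.Reaches π ∧ k ≤ (P.goalsIn (P.lastBelief π)).ncard

/-- `π` is a `j`-legible plan. -/
def IsLegible (P : COProblem) (j : ℕ) (π : List (Fin P.nActions)) : Prop :=
  1 ≤ j ∧ j ≤ P.goals.card ∧ P.Reaches π ∧ (P.goalsIn (P.lastBelief π)).ncard ≤ j

end COProblem

/-- The two variants of the problem. -/
inductive Variant where
  | obfuscation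
  | legibility

/-- An instance of the plan existence problem: a controlled observability planning problem, the
kind of solution that is asked for, and the bound (`k` or `j`). -/
structure COInstance where
  variant : Variant
  bound : ℕ
  problem : COProblem

/-- There is a solution plan: a `k`-ambiguous plan for the goal obfuscation variant with bound `k`,
a `j`-legible plan for the goal legibility variant with bound `j`. -/
def COInstance.HasSolution (q : COInstance) : Prop :=
  match q.variant with
  | .obfuscation => ∃ π, q.problem.IsAmbiguous q.bound π
  | .legibility => ∃ π, q.problem.IsLegible q.bound π

/-! ### Instances as bit strings

Numbers are in unary, subsets of an `n`-element set and states are bit vectors, lists have a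
continuation bit before each entry. All the encodings are self-delimiting. -/

/-- `n` in unary. -/
def encNat (n : ℕ) : List Bool := List.replicate n true ++ [false]

/-- A family of `n` objects, one after the other. -/
def encFun {α : Type} {n : ℕ} (e : α → List Bool) (f : Fin n → α) : List Bool :=
  (List.ofFn fun i => e (f i)).flatten

/-- A list of objects. -/
def encList {α : Type} (e : α → List Bool) : List α → List Bool
  | [] => [false]
  | a :: l => true :: (e a ++ encList e l)

/-- A subset, as a bit vector. -/
def encFinset {n : ℕ} (S : Finset (Fin n)) : List Bool :=
  encFun (fun b : Bool => [b]) fun i => decide (i ∈ S)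

/-- A state, as a bit vector. -/
def encState {n : ℕ} (s : State n) : List Bool := encFun (fun b : Bool => [b]) s

/-- Two bits for each fluent: is it instantiated, and how. -/
def encPartialState {n : ℕ} (g : PartialState n) : List Bool :=
  encFun (fun x : Option Bool => [x.isSome, x.getD false]) g

/-- An action. -/
def encAction {n : ℕ} (a : PlanAction n) : List Bool :=
  encFinset a.pre ++ (encFinset a.add ++ (encFinset a.delete ++ encNat a.cost))

/-- The rules and the default observation of a sensor. -/
def encSensor {n m : ℕ} (r : Sensor n m) : List Bool :=
  encList (fun x : PartialState n × Fin m => encPartialState x.1 ++ encNat x.2.val) r.rules ++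
    encNat r.default.val

/-- A controlled observability planning problem. -/
def encProblem (P : COProblem) : List Bool :=
  encNat P.nFluents ++ (encNat P.nActions ++ (encNat P.nObs ++ (encFun encAction P.action ++
    (encState P.init ++ (encPartialState P.trueGoal ++ (encList encPartialState P.otherGoals ++
      (encSensor P.initSensor ++ encFun encSensor P.sensor)))))))

/-- An instance of the plan existence problem. -/
def encInstance (q : COInstance) : List Bool :=
  (match q.variant with
    | .obfuscation => false
    | .legibility => true) :: (encNat q.bound ++ encProblem q.problem)

/-- An encoding is self-delimiting (hence injective). -/
def SelfDelim {α : Type} (e : α → List Bool) : Prop :=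
  ∀ a b u v, e a ++ u = e b ++ v → a = b ∧ u = v

theorem encNat_selfDelim : SelfDelim encNat := by
  intro a
  induction a with
  | zero =>
    intro b u v h
    cases b with
    | zero => simpa [encNat] using h
    | succ b => simp [encNat, List.replicate_succ] at h
  | succ a ih =>
    intro b u v h
    cases b with
    | zero => simp [encNat, List.replicate_succ] at h
    | succ b =>
      have h2 : encNat a ++ u = encNat b ++ v := by
        simpa [encNat, List.replicate_succ] using h
      obtain ⟨h3, h4⟩ := ih b u v h2
      exact ⟨by rw [h3], h4⟩

theorem encFun_selfDelim {α : Type} {e : α → List Bool} (he : SelfDelim e) (n : ℕ) :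
    SelfDelim (encFun (n := n) e) := by
  induction n with
  | zero =>
    intro a b u v h
    refine ⟨funext fun i => i.elim0, ?_⟩
    simpa [encFun] using h
  | succ n ih =>
    intro a b u v h
    have h2 : e (a 0) ++ (encFun e (fun i : Fin n => a i.succ) ++ u) =
        e (b 0) ++ (encFun e (fun i : Fin n => b i.succ) ++ v) := by
      simpa [encFun, List.ofFn_succ, List.append_assoc] using h
    obtain ⟨h0, h3⟩ := he _ _ _ _ h2
    obtain ⟨h4, h5⟩ := ih _ _ _ _ h3
    refine ⟨funext fun i => ?_, h5⟩
    refine Fin.cases h0 (fun i => ?_) i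
    exact congrFun h4 i

theorem encList_selfDelim {α : Type} {e : α → List Bool} (he : SelfDelim e) :
    SelfDelim (encList e) := by
  intro a
  induction a with
  | nil =>
    intro b u v h
    cases b with
    | nil => simpa [encList] using h
    | cons x b => simp [encList] at h
  | cons y a ih =>
    intro b u v h
    cases b with
    | nil => simp [encList] at h
    | cons x b =>
      have h2 : e y ++ (encList e a ++ u) = e x ++ (encList e b ++ v) := by
        simpa [encList] using h
      obtain ⟨h0, h3⟩ := he _ _ _ _ h2
      obtain ⟨h4, h5⟩ := ih _ _ _ h3
      exact ⟨by rw [h0, h4], h5⟩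

theorem encState_selfDelim {n : ℕ} : SelfDelim (encState (n := n)) :=
  encFun_selfDelim (fun a b u v h => by simpa using h) n

theorem encFinset_selfDelim {n : ℕ} : SelfDelim (encFinset (n := n)) := by
  intro a b u v h
  obtain ⟨h1, h2⟩ := encState_selfDelim (fun i => decide (i ∈ a)) (fun i => decide (i ∈ b)) u v h
  refine ⟨Finset.ext fun i => ?_, h2⟩
  simpa using congrFun h1 i

theorem encPartialState_selfDelim {n : ℕ} : SelfDelim (encPartialState (n := n)) := by
  refine encFun_selfDelim (fun a b u v h => ?_) n
  cases a <;> cases b <;> simpa using h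

theorem encAction_selfDelim {n : ℕ} : SelfDelim (encAction (n := n)) := by
  rintro ⟨p, a, d, c⟩ ⟨p', a', d', c'⟩ u v h
  simp only [encAction, List.append_assoc] at h
  obtain ⟨rfl, k1⟩ := encFinset_selfDelim _ _ _ _ h
  obtain ⟨rfl, k2⟩ := encFinset_selfDelim _ _ _ _ k1
  obtain ⟨rfl, k3⟩ := encFinset_selfDelim _ _ _ _ k2
  obtain ⟨rfl, k4⟩ := encNat_selfDelim _ _ _ _ k3
  exact ⟨rfl, k4⟩

theorem encSensor_selfDelim {n m : ℕ} : SelfDelim (encSensor (n := n) (m := m)) := by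
  have hr : SelfDelim
      (fun x : PartialState n × Fin m => encPartialState x.1 ++ encNat x.2.val) := by
    rintro ⟨g, o⟩ ⟨g', o'⟩ u v h
    simp only [List.append_assoc] at h
    obtain ⟨rfl, k1⟩ := encPartialState_selfDelim _ _ _ _ h
    obtain ⟨h1, k2⟩ := encNat_selfDelim _ _ _ _ k1
    exact ⟨by rw [Fin.ext h1], k2⟩
  rintro ⟨r, d⟩ ⟨r', d'⟩ u v h
  simp only [encSensor, List.append_assoc] at h
  obtain ⟨rfl, k1⟩ := encList_selfDelim hr _ _ _ _ h
  obtain ⟨h1, k2⟩ := encNat_selfDelim _ _ _ _ k1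
  exact ⟨by rw [Fin.ext h1], k2⟩

theorem encProblem_selfDelim : SelfDelim encProblem := by
  rintro ⟨n, k, m, A, I, g, l, r, R⟩ ⟨n', k', m', A', I', g', l', r', R'⟩ u v h
  simp only [encProblem, List.append_assoc] at h
  obtain ⟨rfl, k1⟩ := encNat_selfDelim _ _ _ _ h
  obtain ⟨rfl, k2⟩ := encNat_selfDelim _ _ _ _ k1
  obtain ⟨rfl, k3⟩ := encNat_selfDelim _ _ _ _ k2
  obtain ⟨rfl, k4⟩ := encFun_selfDelim encAction_selfDelim _ _ _ _ _ k3
  obtain ⟨rfl, k5⟩ := encState_selfDelim _ _ _ _ k4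
  obtain ⟨rfl, k6⟩ := encPartialState_selfDelim _ _ _ _ k5
  obtain ⟨rfl, k7⟩ := encList_selfDelim encPartialState_selfDelim _ _ _ _ k6
  obtain ⟨rfl, k8⟩ := encSensor_selfDelim _ _ _ _ k7
  obtain ⟨rfl, k9⟩ := encFun_selfDelim encSensor_selfDelim _ _ _ _ _ k8
  exact ⟨rfl, k9⟩

/-- Distinct instances have distinct encodings. -/
theorem encInstance_selfDelim : SelfDelim encInstance := by
  rintro ⟨x, k, P⟩ ⟨x', k', P'⟩ u v h
  simp only [encInstance, List.cons_append, List.append_assoc, List.cons.injEq] at h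
  obtain ⟨hx, k1⟩ := h
  obtain ⟨rfl, k2⟩ := encNat_selfDelim _ _ _ _ k1
  obtain ⟨rfl, k3⟩ := encProblem_selfDelim _ _ _ _ k2
  cases x <;> cases x' <;> simp_all

/-!
A language decided in exponential space is reduced to plan existence. Mathlib's machines compute on
several stacks, so it suffices to simulate pushes and pops (`FinTM2Sim.machine`), where the height
of each stack is below `2 ^ M` for a polynomial `M` in the length of the input.

The planning problem (`StackMachine.schema`) has polynomially many fluents, so its states cannot
hold the stacks. But the stacks are determined by the history of the stack operations, and the agent
produces this history, action by action, as the word of its observations, while its state keeps only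
the control state of the machine. The action for a `read` may claim any symbol as the top of the
stack; that wrong claims are detected is the purpose of the belief. When a symbol is pushed, the
observer must reckon with the possibility that the agent has instead entered a mode in which it
checks this symbol: the state then holds the stack and the symbol, and `M` bits that count the
symbols above it. The actions that keep this counter up to date emit the same observations as the
operations of the machine, so the last belief contains such a check for each symbol on the stacks
(and for the bottom of each stack). If the counter is `0` and a `read` claims another symbol, the
check enters the mode `error`, which is the other candidate goal, and remains there. Hence the other
goal is impossible exactly if all claims are true, and the plans that reach the true goal,
acceptance, with no other goal possible are the accepting runs
(`StackMachine.exists_isLegible_iff`). This rests on two invariants: as long as the claims are true,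
the belief contains only correct checks (`StackMachine.Sound`) and all of them
(`StackMachine.Complete`). A plan that is 1-legible is always 1-ambiguous, as the state that is
really reached belongs to the last belief (`COProblem.IsLegible.isAmbiguous`).

The problem is uniform in `M`: it has `M` fluents for each of constantly many families, and `M`
actions for each of constantly many templates, and how an action affects the `i`-th fluent of a
family depends only on the comparison of `i` with the index of the action (`Template`, `Schema`).
Therefore a fixed program with a few nested loops over `M` writes it down (`Schema.computable`).
Such programs, in the small language `StackProg`, are compiled to Turing machines with a polynomial
bound on the number of steps (`StackProg.computableInPolyTime`).
-/

/-! ### A small language of stack programs -/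

/-- Programs over finitely many stacks of bits (the stacks are named by `K`). -/
inductive StackProg (K : Type) : Type where
  | skip : StackProg K
  | push (k : K) (b : Bool) : StackProg K
  | drop (k : K) : StackProg K
  | seq (p q : StackProg K) : StackProg K
  /-- While `k` is nonempty: pop it, run `p` if the popped bit is `true`, and `q` otherwise. -/
  | loop (k : K) (p q : StackProg K) : StackProg K

namespace StackProg

variable {K : Type}

/-- The labels that a program needs when it is compiled: one for each loop. -/
def Lab : StackProg K → Type
  | seq p q => Lab p ⊕ Lab q
  | loop _ p q => Option (Lab p ⊕ Lab q)
  | _ => Empty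

/-- There are finitely many labels. -/
@[reducible]
def labFintype : (p : StackProg K) → Fintype p.Lab
  | skip => inferInstanceAs (Fintype Empty)
  | push _ _ => inferInstanceAs (Fintype Empty)
  | drop _ => inferInstanceAs (Fintype Empty)
  | seq p q =>
    letI := labFintype p
    letI := labFintype q
    inferInstanceAs (Fintype (Lab p ⊕ Lab q))
  | loop _ p q =>
    letI := labFintype p
    letI := labFintype q
    inferInstanceAs (Fintype (Option (Lab p ⊕ Lab q)))

/-- The statements of the machines that programs are compiled to; the internal state holds the
bit popped last. -/
abbrev Code (K Λ : Type) : Type := Turing.TM2.Stmt (fun _ : K => Bool) Λ (Option Bool)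

/-- The statement that starts `p` and goes on with `next`; the labels of `p` are placed by `e`. -/
def entry {Λ : Type} : (p : StackProg K) → (p.Lab → Λ) → Code K Λ → Code K Λ
  | skip, _, next => next
  | push k b, _, next => .push k (fun _ => b) next
  | drop k, _, next => .pop k (fun v _ => v) next
  | seq p q, e, next => entry p (fun l => e (.inl l)) (entry q (fun l => e (.inr l)) next)
  | loop _ _ _, e, _ => .goto fun _ => e none

/-- The statements at the labels of `p`. -/
def code {Λ : Type} : (p : StackProg K) → (p.Lab → Λ) → Code K Λ → p.Lab → Code K Λ
  | seq p q, e, next, l =>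
    match l with
    | .inl l => code p (fun l => e (.inl l)) (entry q (fun l => e (.inr l)) next) l
    | .inr l => code q (fun l => e (.inr l)) next l
  | loop k p q, e, next, l =>
    match l with
    | none =>
      .pop k (fun _ x => x)
        (.branch (fun v => v.isSome)
          (.branch (fun v => v.getD false)
            (entry p (fun l => e (some (.inl l))) (.goto fun _ => e none))
            (entry q (fun l => e (some (.inr l))) (.goto fun _ => e none)))
          next)
    | some (.inl l) => code p (fun l => e (some (.inl l))) (.goto fun _ => e none) l
    | some (.inr l) => code q (fun l => e (some (.inr l))) (.goto fun _ => e none) l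
  | skip, _, _, l => nomatch l
  | push _ _, _, _, l => nomatch l
  | drop _, _, _, l => nomatch l

variable [DecidableEq K]

/-- `Exec p s s' t`: run on the stacks `s`, the program `p` ends with the stacks `s'`; the compiled
program needs `t` steps for it. Only jumps cost time: the straight-line code in between is executed
by the machine in the same step. -/
inductive Exec : StackProg K → (K → List Bool) → (K → List Bool) → ℕ → Prop
  | skip (s : K → List Bool) : Exec skip s s 0
  | push (k : K) (b : Bool) (s : K → List Bool) :
      Exec (push k b) s (Function.update s k (b :: s k)) 0
  | drop (k : K) (s : K → List Bool) : Exec (drop k) s (Function.update s k (s k).tail) 0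
  | seq {p q : StackProg K} {s s₁ s₂ : K → List Bool} {t₁ t₂ : ℕ}
      (hp : Exec p s s₁ t₁) (hq : Exec q s₁ s₂ t₂) : Exec (seq p q) s s₂ (t₂ + t₁)
  | loop_nil {k : K} (p q : StackProg K) {s : K → List Bool} (h : s k = []) :
      Exec (loop k p q) s s 1
  | loop_true {k : K} {p q : StackProg K} {s s₁ s₂ : K → List Bool} {l : List Bool} {t₁ t₂ : ℕ}
      (h : s k = true :: l) (hp : Exec p (Function.update s k l) s₁ t₁)
      (hl : Exec (loop k p q) s₁ s₂ t₂) : Exec (loop k p q) s s₂ (t₂ + t₁ + 1)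
  | loop_false {k : K} {p q : StackProg K} {s s₁ s₂ : K → List Bool} {l : List Bool} {t₁ t₂ : ℕ}
      (h : s k = false :: l) (hq : Exec q (Function.update s k l) s₁ t₁)
      (hl : Exec (loop k p q) s₁ s₂ t₂) : Exec (loop k p q) s s₂ (t₂ + t₁ + 1)

/-- The compiled program does what `Exec` says. Here `m` may contain other code than that of `p`, so
that the statement applies to subprograms. -/
theorem Exec.run {Λ : Type} (m : Λ → Code K Λ) {p : StackProg K} {s s' : K → List Bool} {t : ℕ}
    (h : Exec p s s' t) :
    ∀ (e : p.Lab → Λ) (next : Code K Λ), (∀ l, m (e l) = code p e next l) → ∀ v, ∃ v',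
      (flip bind (Turing.TM2.step m))^[t] (some (Turing.TM2.stepAux (entry p e next) v s)) =
        some (Turing.TM2.stepAux next v' s') := by
  induction h with
  | skip s => exact fun e next _ v => ⟨v, rfl⟩
  | push k b s => exact fun e next _ v => ⟨v, rfl⟩
  | drop k s => exact fun e next _ v => ⟨v, rfl⟩
  | seq _ _ ihp ihq =>
    intro e next hm v
    obtain ⟨v₁, h₁⟩ := ihp (fun l => e (.inl l)) _ (fun l => hm (.inl l)) v
    obtain ⟨v₂, h₂⟩ := ihq (fun l => e (.inr l)) next (fun l => hm (.inr l)) v₁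
    exact ⟨v₂, by rw [Function.iterate_add_apply, entry, h₁, h₂]⟩
  | @loop_nil k p q s h =>
    intro e next hm v
    refine ⟨none, ?_⟩
    have h0 := hm none
    simp only [code] at h0
    have h1 : Function.update s k [] = s := by rw [← h, Function.update_eq_self]
    simp [entry, flip, h0, h, h1]
  | loop_true h _ _ ihp ihl =>
    intro e next hm v
    have h0 := hm none
    simp only [code] at h0
    obtain ⟨v₁, h₁⟩ := ihp (fun l => e (some (.inl l))) _ (fun l => hm (some (.inl l))) (some true)
    obtain ⟨v₂, h₂⟩ := ihl e next hm v₁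
    refine ⟨v₂, ?_⟩
    rw [Function.iterate_succ_apply, Function.iterate_add_apply, ← h₂, entry, ← h₁]
    simp [flip, h0, h]
  | loop_false h _ _ ihp ihl =>
    intro e next hm v
    have h0 := hm none
    simp only [code] at h0
    obtain ⟨v₁, h₁⟩ := ihp (fun l => e (some (.inr l))) _ (fun l => hm (some (.inr l))) (some false)
    obtain ⟨v₂, h₂⟩ := ihl e next hm v₁
    refine ⟨v₂, ?_⟩
    rw [Function.iterate_succ_apply, Function.iterate_add_apply, ← h₂, entry, ← h₁]
    simp [flip, h0, h]

/-- The machine that runs `p` with input stack `k₀` and output stack `k₁`, and then resets its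
internal state and halts. -/
def machine [Fintype K] (p : StackProg K) (k₀ k₁ : K) : Turing.FinTM2 where
  K := K
  k₀ := k₀
  k₁ := k₁
  Γ _ := Bool
  Λ := Option p.Lab
  main := none
  ΛFin := letI := labFintype p; inferInstance
  σ := Option Bool
  initialState := none
  m
    | none => entry p some (.load (fun _ => none) .halt)
    | some l => code p some (.load (fun _ => none) .halt) l

/-- `p` leads from `s` to `s'` in at most `T` steps. -/
def ExecIn (p : StackProg K) (s s' : K → List Bool) (T : ℕ) : Prop := ∃ t ≤ T, Exec p s s' t

theorem ExecIn.mono {p : StackProg K} {s s' : K → List Bool} {T T' : ℕ} (h : ExecIn p s s' T)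
    (hT : T ≤ T') : ExecIn p s s' T' :=
  let ⟨t, ht, he⟩ := h
  ⟨t, ht.trans hT, he⟩

theorem ExecIn.seq {p q : StackProg K} {s s₁ s₂ : K → List Bool} {T₁ T₂ : ℕ}
    (hp : ExecIn p s s₁ T₁) (hq : ExecIn q s₁ s₂ T₂) : ExecIn (seq p q) s s₂ (T₁ + T₂) := by
  obtain ⟨t₁, ht₁, h₁⟩ := hp
  obtain ⟨t₂, ht₂, h₂⟩ := hq
  exact ⟨t₂ + t₁, by omega, .seq h₁ h₂⟩

theorem ExecIn.skip (s : K → List Bool) : ExecIn skip s s 0 := ⟨0, le_rfl, .skip s⟩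

theorem ExecIn.push (k : K) (b : Bool) (s : K → List Bool) :
    ExecIn (push k b) s (Function.update s k (b :: s k)) 0 := ⟨0, le_rfl, .push k b s⟩

theorem ExecIn.drop (k : K) (s : K → List Bool) :
    ExecIn (drop k) s (Function.update s k (s k).tail) 0 := ⟨0, le_rfl, .drop k s⟩

theorem ExecIn.loop_nil {k : K} (p q : StackProg K) {s : K → List Bool} (h : s k = []) :
    ExecIn (loop k p q) s s 1 := ⟨1, le_rfl, .loop_nil p q h⟩

theorem ExecIn.loop_cons {k : K} {p q : StackProg K} {s s₁ s₂ : K → List Bool} {b : Bool}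
    {l : List Bool} {T₁ T₂ : ℕ} (h : s k = b :: l)
    (hp : ExecIn (if b then p else q) (Function.update s k l) s₁ T₁)
    (hl : ExecIn (loop k p q) s₁ s₂ T₂) : ExecIn (loop k p q) s s₂ (T₁ + T₂ + 1) := by
  obtain ⟨t₁, ht₁, h₁⟩ := hp
  obtain ⟨t₂, ht₂, h₂⟩ := hl
  refine ⟨t₂ + t₁ + 1, by omega, ?_⟩
  cases b
  · exact .loop_false h h₁ h₂
  · exact .loop_true h h₁ h₂

/-- The rule for a loop over a number in unary: `s i` are the stacks when `i` rounds remain. -/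
theorem ExecIn.loop_unary {k : K} {p : StackProg K} {T : ℕ} (s : ℕ → K → List Bool) (m : ℕ)
    (hs : ∀ i ≤ m, s i k = List.replicate i true)
    (h : ∀ i < m, ExecIn p (Function.update (s (i + 1)) k (List.replicate i true)) (s i) T) :
    ExecIn (loop k p p) (s m) (s 0) (m * (T + 1) + 1) := by
  induction m with
  | zero => exact (loop_nil p p (by simpa using hs 0 le_rfl)).mono (by omega)
  | succ m ih =>
    have ih' := ih (fun i hi => hs i (by omega)) (fun i hi => h i (by omega))
    refine (loop_cons (b := true) (by simpa [List.replicate_succ] using hs (m + 1) le_rfl)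
      (by simpa using h m (by omega)) ih').mono (by ring_nf; omega)

/-- A program that turns an input on `k₀` into the corresponding output on `k₁`, all other stacks
being empty before and after, in polynomial time, makes the function polynomial-time computable. -/
theorem computableInPolyTime [Fintype K] {α : Type} {enc : α → List Bool} {f : List Bool → α}
    (p : StackProg K) (k₀ k₁ : K) (T : Polynomial ℕ)
    (h : ∀ w : List Bool, ExecIn p (Function.update (fun _ => []) k₀ w)
      (Function.update (fun _ => []) k₁ (enc (f w))) (T.eval w.length)) :
    Nonempty (Turing.TM2ComputableInPolyTime (id : List Bool → List Bool) enc f) := by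
  refine ⟨⟨⟨machine p k₀ k₁, Equiv.refl Bool, Equiv.refl Bool⟩, T + 1, fun w => ?_⟩⟩
  let t := (h w).choose
  have hT : t ≤ T.eval w.length := (h w).choose_spec.1
  have hE : Exec p _ _ t := (h w).choose_spec.2
  refine ⟨⟨t + 1, ?_⟩, by simpa using hT⟩
  obtain ⟨v, hv⟩ := hE.run (machine p k₀ k₁).m some (.load (fun _ => none) .halt)
    (fun l => rfl) none
  have hi : Turing.initList (machine p k₀ k₁) w =
      (⟨some none, none, Function.update (fun _ => []) k₀ w⟩ :
        Turing.TM2.Cfg (fun _ : K => Bool) (Option p.Lab) (Option Bool)) := by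
    unfold Turing.initList
    congr 1
    refine funext fun (k : K) => ?_
    by_cases hk : k = k₀
    · subst hk
      exact (dif_pos rfl).trans (Function.update_self k w fun _ => []).symm
    · exact (dif_neg hk).trans (Function.update_of_ne hk w fun _ => []).symm
  have ho : Turing.haltList (machine p k₀ k₁) (enc (f w)) =
      (⟨none, none, Function.update (fun _ => []) k₁ (enc (f w))⟩ :
        Turing.TM2.Cfg (fun _ : K => Bool) (Option p.Lab) (Option Bool)) := by
    unfold Turing.haltList
    congr 1
    refine funext fun (k : K) => ?_
    by_cases hk : k = k₁
    · subst hk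
      exact (dif_pos rfl).trans (Function.update_self k (enc (f w)) fun _ => []).symm
    · exact (dif_neg hk).trans (Function.update_of_ne hk (enc (f w)) fun _ => []).symm
  have hm : (flip bind (machine p k₀ k₁).step)^[t + 1]
      (some (Turing.initList (machine p k₀ k₁) w)) =
        some (Turing.haltList (machine p k₀ k₁) (enc (f w))) := by
    rw [hi, ho, Function.iterate_succ_apply]
    exact hv
  have he : ∀ l : List Bool, List.map (Equiv.refl Bool).invFun l = l := List.map_id
  exact (congrArg (fun l => (flip bind (machine p k₀ k₁).step)^[t + 1]
    (some (Turing.initList (machine p k₀ k₁) l))) (he w)).trans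
      (hm.trans (congrArg (fun l => some (Turing.haltList (machine p k₀ k₁) l)) (he _)).symm)

end StackProg

/-! ### Programs that write bit strings -/

/-- The stacks of the programs below: the input, the length of the input, the size parameter (split
into two counters when it is looped over), a scratch stack, the output written so far (last bit on
top), and the output. -/
inductive Reg : Type where
  | inp | len | todo | done | tmp | rev | out
  deriving DecidableEq

instance : Fintype Reg :=
  Fintype.ofList [.inp, .len, .todo, .done, .tmp, .rev, .out] fun k => by cases k <;> simp

namespace StackProg

/-- The stacks with the given contents; the counters hold numbers in unary, and `o` is the output
written so far, in the order of writing. -/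
def regs (w : List Bool) (n r d : ℕ) (e o out : List Bool) : Reg → List Bool
  | .inp => w
  | .len => List.replicate n true
  | .todo => List.replicate r true
  | .done => List.replicate d true
  | .tmp => e
  | .rev => o.reverse
  | .out => out

section update

variable (w : List Bool) (n r d : ℕ) (e o out : List Bool)

@[simp]
theorem update_regs_inp (w' : List Bool) :
    Function.update (regs w n r d e o out) .inp w' = regs w' n r d e o out := by
  funext k; cases k <;> rfl

@[simp]
theorem update_regs_len (n' : ℕ) :
    Function.update (regs w n r d e o out) .len (List.replicate n' true) =
      regs w n' r d e o out := by
  funext k; cases k <;> rfl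

@[simp]
theorem update_regs_todo (r' : ℕ) :
    Function.update (regs w n r d e o out) .todo (List.replicate r' true) =
      regs w n r' d e o out := by
  funext k; cases k <;> rfl

@[simp]
theorem update_regs_done (d' : ℕ) :
    Function.update (regs w n r d e o out) .done (List.replicate d' true) =
      regs w n r d' e o out := by
  funext k; cases k <;> rfl

@[simp]
theorem update_regs_tmp (e' : List Bool) :
    Function.update (regs w n r d e o out) .tmp e' = regs w n r d e' o out := by
  funext k; cases k <;> rfl

theorem push_inp (b : Bool) :
    ExecIn (push .inp b) (regs w n r d e o out) (regs (b :: w) n r d e o out) 0 := by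
  simpa [regs] using ExecIn.push .inp b (regs w n r d e o out)

theorem push_len :
    ExecIn (push .len true) (regs w n r d e o out) (regs w (n + 1) r d e o out) 0 := by
  convert ExecIn.push .len true (regs w n r d e o out) using 1
  exact (update_regs_len w n r d e o out (n + 1)).symm

theorem push_todo :
    ExecIn (push .todo true) (regs w n r d e o out) (regs w n (r + 1) d e o out) 0 := by
  convert ExecIn.push .todo true (regs w n r d e o out) using 1
  exact (update_regs_todo w n r d e o out (r + 1)).symm

theorem drop_todo :
    ExecIn (drop .todo) (regs w n (r + 1) d e o out) (regs w n r d e o out) 0 := by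
  convert ExecIn.drop .todo (regs w n (r + 1) d e o out) using 1
  exact (update_regs_todo w n (r + 1) d e o out r).symm

theorem push_done :
    ExecIn (push .done true) (regs w n r d e o out) (regs w n r (d + 1) e o out) 0 := by
  convert ExecIn.push .done true (regs w n r d e o out) using 1
  exact (update_regs_done w n r d e o out (d + 1)).symm

theorem push_tmp (b : Bool) :
    ExecIn (push .tmp b) (regs w n r d e o out) (regs w n r d (b :: e) o out) 0 := by
  simpa [regs] using ExecIn.push .tmp b (regs w n r d e o out)

theorem push_rev (b : Bool) :
    ExecIn (push .rev b) (regs w n r d e o out) (regs w n r d e (o ++ [b]) out) 0 := by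
  convert ExecIn.push .rev b (regs w n r d e o out) using 1
  funext k; cases k <;> simp [regs]

theorem push_out (b : Bool) :
    ExecIn (push .out b) (regs w n r d e o out) (regs w n r d e o (b :: out)) 0 := by
  convert ExecIn.push .out b (regs w n r d e o out) using 1
  funext k; cases k <;> simp [regs]

end update

/-- A list of programs, one after the other. -/
def seqs : List (StackProg Reg) → StackProg Reg
  | [] => skip
  | p :: l => seq p (seqs l)

/-- Copy the bits of `tmp` back to `inp`. -/
def restoreInp : StackProg Reg := loop .tmp (push .inp true) (push .inp false)

theorem restoreInp_exec (w : List Bool) (n r d : ℕ) (e o out : List Bool) :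
    ExecIn restoreInp (regs w n r d e o out) (regs (e.reverse ++ w) n r d [] o out)
      (e.length + 1) := by
  induction e generalizing w with
  | nil => exact ExecIn.loop_nil _ _ rfl
  | cons b e ih =>
    have h := ih (b :: w)
    refine ExecIn.mono (ExecIn.loop_cons (k := .tmp) (s := regs w n r d (b :: e) o out) (b := b)
      (l := e) (s₁ := regs (b :: w) n r d e o out) (T₁ := 0) (T₂ := e.length + 1) rfl ?_ ?_)
      (by simp)
    · rw [update_regs_tmp]
      cases b
      · exact push_inp ..
      · exact push_inp ..
    · simpa [restoreInp] using h

/-- Write the length of the input to `len`. -/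
def measure : StackProg Reg :=
  seq (loop .inp (seq (push .tmp true) (push .len true)) (seq (push .tmp false) (push .len true)))
    restoreInp

theorem measure_exec (w : List Bool) :
    ExecIn measure (regs w 0 0 0 [] [] []) (regs w w.length 0 0 [] [] []) (2 * w.length + 2) := by
  have key : ∀ (l e : List Bool) (n : ℕ),
      ExecIn (loop .inp (seq (push .tmp true) (push .len true))
        (seq (push .tmp false) (push .len true))) (regs l n 0 0 e [] [])
        (regs [] (n + l.length) 0 0 (l.reverse ++ e) [] []) (l.length + 1) := by
    intro l
    induction l with
    | nil => exact fun e n => ExecIn.loop_nil _ _ rfl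
    | cons b l ih =>
      intro e n
      have h := ih (b :: e) (n + 1)
      have h' : ExecIn (loop .inp (seq (push .tmp true) (push .len true))
          (seq (push .tmp false) (push .len true))) (regs l (n + 1) 0 0 (b :: e) [] [])
          (regs [] (n + (b :: l).length) 0 0 ((b :: l).reverse ++ e) [] []) (l.length + 1) := by
        convert h using 2
        · simp; omega
        · simp
      refine ExecIn.mono (ExecIn.loop_cons (k := .inp) (s := regs (b :: l) n 0 0 e [] []) (b := b)
        (l := l) (T₁ := 0 + 0) (T₂ := l.length + 1) rfl ?_ h') (by simp)
      rw [update_regs_inp]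
      cases b
      · exact (push_tmp ..).seq (push_len ..)
      · exact (push_tmp ..).seq (push_len ..)
  refine ((key w [] 0).seq (restoreInp_exec ..)).mono (T' := 2 * w.length + 2) (by simp; omega)
    |> fun h => ?_
  simpa [measure] using h

/-- Multiply the number on `todo` by `a` plus the number on `len`. The two branches of the outer
loop are equal, as counters only hold `true`. -/
def mulStep (a : ℕ) : StackProg Reg :=
  seq (loop .todo (push .done true) (push .done true))
    (loop .done
      (seq (seqs (List.replicate a (push .todo true)))
        (seq (loop .len (seq (push .todo true) (push .tmp true))
            (seq (push .todo true) (push .tmp true)))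
          (loop .tmp (push .len true) (push .len true))))
      (seq (seqs (List.replicate a (push .todo true)))
        (seq (loop .len (seq (push .todo true) (push .tmp true))
            (seq (push .todo true) (push .tmp true)))
          (loop .tmp (push .len true) (push .len true)))))

theorem pushes_todo (a : ℕ) (w : List Bool) (n r d : ℕ) (e o out : List Bool) :
    ExecIn (seqs (List.replicate a (push .todo true))) (regs w n r d e o out)
      (regs w n (r + a) d e o out) 0 := by
  induction a generalizing r with
  | zero => exact ExecIn.skip _
  | succ a ih =>
    have h := (push_todo w n r d e o out).seq (ih (r + 1))
    rw [show r + (a + 1) = r + 1 + a by omega]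
    exact h

theorem mulStep_exec (a : ℕ) (w : List Bool) (n x : ℕ) :
    ExecIn (mulStep a) (regs w n x 0 [] [] []) (regs w n (x * (n + a)) 0 [] [] [])
      (x * (2 * n + 4) + 2) := by
  have h1 : ExecIn (loop .todo (push .done true) (push .done true)) (regs w n x 0 [] [] [])
      (regs w n 0 x [] [] []) (x * (0 + 1) + 1) := by
    have := ExecIn.loop_unary (p := push .done true) (k := .todo) (T := 0)
      (fun i => regs w n i (x - i) [] [] []) x (fun i _ => rfl) (fun i hi => by
        rw [update_regs_todo]
        have := push_done w n i (x - (i + 1)) [] [] []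
        rwa [show x - (i + 1) + 1 = x - i by omega] at this)
    simpa using this
  have h2 : ∀ r d : ℕ, ExecIn (loop .len (seq (push .todo true) (push .tmp true))
            (seq (push .todo true) (push .tmp true))) (regs w n r d [] [] [])
            (regs w 0 (r + n) d (List.replicate n true) [] []) (n + 1) := by
    intro r d
    have := ExecIn.loop_unary (p := seq (push .todo true) (push .tmp true)) (k := .len) (T := 0)
      (fun i => regs w i (r + (n - i)) d (List.replicate (n - i) true) [] []) n (fun i _ => rfl)
      (fun i hi => by
        rw [update_regs_len]
        have := (push_todo w i (r + (n - (i + 1))) d (List.replicate (n - (i + 1)) true) [] []).seq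
          (push_tmp _ _ _ _ _ _ _ true)
        rwa [← List.replicate_succ, add_assoc, show n - (i + 1) + 1 = n - i by omega] at this)
    simpa using this
  have h3 : ∀ r d : ℕ, ExecIn (loop .tmp (push .len true) (push .len true))
      (regs w 0 r d (List.replicate n true) [] []) (regs w n r d [] [] []) (n + 1) := by
    intro r d
    have := ExecIn.loop_unary (p := push .len true) (k := .tmp) (T := 0)
      (fun i => regs w (n - i) r d (List.replicate i true) [] []) n (fun i _ => rfl)
      (fun i hi => by
        rw [update_regs_tmp]
        have := push_len w (n - (i + 1)) r d (List.replicate i true) [] []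
        rwa [show n - (i + 1) + 1 = n - i by omega] at this)
    simpa using this
  have h4 := ExecIn.loop_unary (k := .done) (T := 0 + (n + 1 + (n + 1)))
      (fun i => regs w n ((x - i) * (n + a)) i [] [] []) x (fun i _ => rfl)
      (fun i hi => by
        rw [update_regs_done]
        have := (pushes_todo a w n ((x - (i + 1)) * (n + a)) i [] [] []).seq
          ((h2 _ _).seq (h3 _ _))
        have e : (x - (i + 1)) * (n + a) + a + n = (x - i) * (n + a) := by
          rw [show x - i = x - (i + 1) + 1 by omega]; ring
        rwa [e] at this)
  simp only [Nat.sub_self, Nat.sub_zero, zero_mul] at h4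
  exact (h1.seq h4).mono (by ring_nf; omega)

/-- Write the `D`-th power of `a` plus the length of the input to `todo`. -/
def power (a D : ℕ) : StackProg Reg :=
  seq measure (seq (push .todo true)
    (seq (seqs (List.replicate D (mulStep a))) (loop .len skip skip)))

theorem power_exec (a D : ℕ) (ha : 1 ≤ a) (w : List Bool) :
    ExecIn (power a D) (regs w 0 0 0 [] [] []) (regs w 0 ((w.length + a) ^ D) 0 [] [] [])
      (3 * w.length + 3 + D * ((w.length + a) ^ D * (2 * w.length + 4) + 2)) := by
  have key : ∀ i j : ℕ, i + j = D → ExecIn (seqs (List.replicate i (mulStep a)))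
      (regs w w.length ((w.length + a) ^ j) 0 [] [] [])
      (regs w w.length ((w.length + a) ^ D) 0 [] [] [])
      (i * ((w.length + a) ^ D * (2 * w.length + 4) + 2)) := by
    intro i
    induction i with
    | zero =>
      intro j hj
      rw [show j = D by omega]
      exact (ExecIn.skip _).mono (by omega)
    | succ i ih =>
      intro j hj
      have h1 := mulStep_exec a w w.length ((w.length + a) ^ j)
      rw [← pow_succ] at h1
      refine (h1.seq (ih (j + 1) (by omega))).mono ?_
      have : (w.length + a) ^ j ≤ (w.length + a) ^ D := Nat.pow_le_pow_right (by omega) (by omega)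
      have := Nat.mul_le_mul_right (2 * w.length + 4) this
      rw [Nat.succ_mul i]
      omega
  have h4 : ∀ x, ExecIn (loop .len skip skip) (regs w w.length x 0 [] [] [])
      (regs w 0 x 0 [] [] []) (w.length * (0 + 1) + 1) := fun x =>
    ExecIn.loop_unary (fun i => regs w i x 0 [] [] []) w.length (fun i _ => rfl)
      (fun i hi => by rw [update_regs_len]; exact ExecIn.skip _)
  refine ((measure_exec w).seq ((push_todo _ _ _ _ _ _ _).seq ((key D 0 rfl).seq (h4 _)))).mono ?_
  omega

/-- `p` writes `l` when the input is `w` and the counters hold `r` and `d`; the running time and the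
length of `l` are at most `T`. -/
def Emits (p : StackProg Reg) (w : List Bool) (r d : ℕ) (l : List Bool) (T : ℕ) : Prop :=
  l.length ≤ T ∧ ∀ o, ExecIn p (regs w 0 r d [] o []) (regs w 0 r d [] (o ++ l) []) T

theorem Emits.mono {p : StackProg Reg} {w : List Bool} {r d : ℕ} {l : List Bool} {T T' : ℕ}
    (h : Emits p w r d l T) (hT : T ≤ T') : Emits p w r d l T' :=
  ⟨h.1.trans hT, fun o => (h.2 o).mono hT⟩

theorem Emits.seq {p q : StackProg Reg} {w : List Bool} {r d : ℕ} {l l' : List Bool} {T T' : ℕ}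
    (hp : Emits p w r d l T) (hq : Emits q w r d l' T') :
    Emits (seq p q) w r d (l ++ l') (T + T') := by
  refine ⟨by simpa using Nat.add_le_add hp.1 hq.1, fun o => ?_⟩
  rw [← List.append_assoc]
  exact (hp.2 o).seq (hq.2 _)

/-- Write `l`. -/
def lit (l : List Bool) : StackProg Reg := seqs (l.map (push .rev))

theorem lit_exec (l w : List Bool) (n r d : ℕ) (e o out : List Bool) :
    ExecIn (lit l) (regs w n r d e o out) (regs w n r d e (o ++ l) out) 0 := by
  induction l generalizing o with
  | nil => simpa [lit, seqs] using ExecIn.skip _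
  | cons b l ih => simpa [lit, seqs] using (push_rev w n r d e o out b).seq (ih (o ++ [b]))

theorem emits_lit (l w : List Bool) (r d : ℕ) : Emits (lit l) w r d l l.length :=
  ⟨le_rfl, fun _ => (lit_exec ..).mono (Nat.zero_le _)⟩

theorem emits_flatMap {ι : Type} (L : List ι) {p : ι → StackProg Reg} {w : List Bool} {r d : ℕ}
    {l : ι → List Bool} {T : ℕ} (h : ∀ x ∈ L, Emits (p x) w r d (l x) T) :
    Emits (seqs (L.map p)) w r d (L.flatMap l) (L.length * T) := by
  induction L with
  | nil => exact ⟨by simp, fun o => by simpa [seqs] using ExecIn.skip _⟩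
  | cons x L ih =>
    have := (h x (by simp)).seq (ih fun y hy => h y (by simp [hy]))
    refine (this.mono (T' := (x :: L).length * T) ?_)
    simp only [List.length_cons, Nat.succ_mul]
    omega

/-- Move the number on `done` back to `todo`. -/
def restoreTodo : StackProg Reg := loop .done (push .todo true) (push .todo true)

theorem restoreTodo_exec (w : List Bool) (n r d : ℕ) (e o out : List Bool) :
    ExecIn restoreTodo (regs w n r d e o out) (regs w n (r + d) 0 e o out) (d + 1) := by
  have := ExecIn.loop_unary (p := push .todo true) (k := .done) (T := 0)
    (fun i => regs w n (r + (d - i)) i e o out) d (fun i _ => rfl) (fun i hi => by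
      rw [update_regs_done]
      have := push_todo w n (r + (d - (i + 1))) i e o out
      rwa [add_assoc, show d - (i + 1) + 1 = d - i by omega] at this)
  simpa [restoreTodo] using this

/-- Run `p` once for each unit on `todo`; the units already used are on `done`. -/
def rows (p : StackProg Reg) : StackProg Reg :=
  seq (loop .todo (seq p (push .done true)) (seq p (push .done true))) restoreTodo

/-- In the row with `d` units on `done`, there are `M - d - 1` units on `todo`: the current unit is
on neither of them. -/
theorem emits_rows {p : StackProg Reg} {w : List Bool} {M : ℕ} {row : ℕ → List Bool} {T : ℕ}
    (h : ∀ r d, r + d + 1 = M → Emits p w r d (row d) T) :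
    Emits (rows p) w M 0 ((List.range M).flatMap row) (M * (T + 2) + 2) := by
  constructor
  · have : ∀ m ≤ M, ((List.range m).flatMap row).length ≤ m * T := by
      intro m hm
      induction m with
      | zero => simp
      | succ m ih =>
        have h1 := (h (M - 1 - m) m (by omega)).1
        have h2 := ih (by omega)
        simp only [List.range_succ, List.flatMap_append, List.length_append, Nat.succ_mul]
        simpa using Nat.add_le_add h2 h1
    refine (this M le_rfl).trans ?_
    ring_nf; omega
  · intro o
    have h1 := ExecIn.loop_unary (p := StackProg.seq p (push .done true)) (k := .todo) (T := T + 0)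
      (fun i => regs w 0 i (M - i) [] (o ++ (List.range (M - i)).flatMap row) []) M
      (fun i _ => rfl) (fun i hi => by
        rw [update_regs_todo]
        have := ((h i (M - (i + 1)) (by omega)).2
          (o ++ (List.range (M - (i + 1))).flatMap row)).seq (push_done ..)
        rw [List.append_assoc, show M - (i + 1) + 1 = M - i by omega] at this
        convert this using 4
        rw [show M - i = M - (i + 1) + 1 by omega, List.range_succ]
        simp)
    have h2 := restoreTodo_exec w 0 0 M [] (o ++ (List.range M).flatMap row) []
    simp only [Nat.sub_self, List.range_zero, List.flatMap_nil, List.append_nil, Nat.sub_zero] at h1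
    rw [zero_add] at h2
    exact (h1.seq h2).mono (by ring_nf; omega)

/-- Write `a` for each unit on `done`, then `b`, then `c` for each unit on `todo`. -/
def threeWay (a b c : Bool) : StackProg Reg :=
  seq (seq (loop .done (seq (lit [a]) (push .tmp true)) (seq (lit [a]) (push .tmp true)))
      (loop .tmp (push .done true) (push .done true)))
    (seq (lit [b])
      (seq (loop .todo (seq (lit [c]) (push .tmp true)) (seq (lit [c]) (push .tmp true)))
        (loop .tmp (push .todo true) (push .todo true))))

theorem emits_threeWay (a b c : Bool) (w : List Bool) (r d : ℕ) :
    Emits (threeWay a b c) w r d (List.replicate d a ++ ([b] ++ List.replicate r c))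
      (2 * (r + d) + 5) := by
  have h1 : Emits (StackProg.seq
      (loop .done (StackProg.seq (lit [a]) (push .tmp true))
        (StackProg.seq (lit [a]) (push .tmp true)))
      (loop .tmp (push .done true) (push .done true))) w r d (List.replicate d a)
      (2 * d + 2) := by
    refine ⟨by simp; omega, fun o => ?_⟩
    have h1 := ExecIn.loop_unary (p := StackProg.seq (lit [a]) (push .tmp true)) (k := .done)
      (T := 0)
      (fun i => regs w 0 r i (List.replicate (d - i) true) (o ++ List.replicate (d - i) a) []) d
      (fun i _ => rfl) (fun i hi => by
        rw [update_regs_done]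
        have := (lit_exec [a] w 0 r i (List.replicate (d - (i + 1)) true)
          (o ++ List.replicate (d - (i + 1)) a) []).seq (push_tmp _ _ _ _ _ _ _ true)
        rwa [← List.replicate_succ, List.append_assoc, ← List.replicate_succ',
          show d - (i + 1) + 1 = d - i by omega] at this)
    have h2 := ExecIn.loop_unary (p := push .done true) (k := .tmp) (T := 0)
      (fun i => regs w 0 r (d - i) (List.replicate i true) (o ++ List.replicate d a) []) d
      (fun i _ => rfl) (fun i hi => by
        rw [update_regs_tmp]
        have := push_done w 0 r (d - (i + 1)) (List.replicate i true) (o ++ List.replicate d a) []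
        rwa [show d - (i + 1) + 1 = d - i by omega] at this)
    refine (ExecIn.seq (by simpa using h1) (by simpa using h2)).mono (by omega)
  have h2 : Emits (StackProg.seq
      (loop .todo (StackProg.seq (lit [c]) (push .tmp true))
        (StackProg.seq (lit [c]) (push .tmp true)))
      (loop .tmp (push .todo true) (push .todo true))) w r d (List.replicate r c)
      (2 * r + 2) := by
    refine ⟨by simp; omega, fun o => ?_⟩
    have h1 := ExecIn.loop_unary (p := StackProg.seq (lit [c]) (push .tmp true)) (k := .todo)
      (T := 0)
      (fun i => regs w 0 i d (List.replicate (r - i) true) (o ++ List.replicate (r - i) c) []) r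
      (fun i _ => rfl) (fun i hi => by
        rw [update_regs_todo]
        have := (lit_exec [c] w 0 i d (List.replicate (r - (i + 1)) true)
          (o ++ List.replicate (r - (i + 1)) c) []).seq (push_tmp _ _ _ _ _ _ _ true)
        rwa [← List.replicate_succ, List.append_assoc, ← List.replicate_succ',
          show r - (i + 1) + 1 = r - i by omega] at this)
    have h2 := ExecIn.loop_unary (p := push .todo true) (k := .tmp) (T := 0)
      (fun i => regs w 0 (r - i) d (List.replicate i true) (o ++ List.replicate r c) []) r
      (fun i _ => rfl) (fun i hi => by
        rw [update_regs_tmp]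
        have := push_todo w 0 (r - (i + 1)) d (List.replicate i true) (o ++ List.replicate r c) []
        rwa [show r - (i + 1) + 1 = r - i by omega] at this)
    refine (ExecIn.seq (by simpa using h1) (by simpa using h2)).mono (by omega)
  exact (h1.seq ((emits_lit [b] w r d).seq h2)).mono (by simp; omega)

/-- Write one bit for each unit on `todo`: is the corresponding input bit `b`? The value `none`
stands for the positions past the end of the input. -/
def inputRow (b : Option Bool) : StackProg Reg :=
  seq (loop .inp
      (seq (lit [decide (some true = b)])
        (seq (push .tmp true) (seq (drop .todo) (push .done true))))
      (seq (lit [decide (some false = b)])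
        (seq (push .tmp false) (seq (drop .todo) (push .done true)))))
    (seq (loop .todo (seq (lit [decide (none = b)]) (push .done true))
        (seq (lit [decide (none = b)]) (push .done true)))
      (seq restoreTodo restoreInp))

theorem emits_inputRow (b : Option Bool) (w : List Bool) (M : ℕ) (hM : w.length ≤ M) :
    Emits (inputRow b) w M 0 ((List.range M).map fun i => decide (w[i]? = b)) (3 * M + 4) := by
  have hl : ((List.range M).map fun i => decide (w[i]? = b)) =
      w.map (fun x => decide (some x = b)) ++
        List.replicate (M - w.length) (decide (none = b)) := by
    apply List.ext_getElem
    · simp; omega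
    · intro i h1 h2
      by_cases hi : i < w.length
      · simp [List.getElem_append_left, hi]
      · simp [List.getElem_append_right, not_lt.1 hi]
  refine ⟨by simp; omega, fun o => ?_⟩
  have key : ∀ (l e o : List Bool) (r d : ℕ),
      ExecIn (loop .inp
        (StackProg.seq (lit [decide (some true = b)])
          (StackProg.seq (push .tmp true) (StackProg.seq (drop .todo) (push .done true))))
        (StackProg.seq (lit [decide (some false = b)])
          (StackProg.seq (push .tmp false) (StackProg.seq (drop .todo) (push .done true)))))
        (regs l 0 (r + l.length) d e o [])
        (regs [] 0 r (d + l.length) (l.reverse ++ e) (o ++ l.map fun x => decide (some x = b)) [])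
        (l.length + 1) := by
    intro l
    induction l with
    | nil => intro e o r d; simpa using ExecIn.loop_nil _ _ rfl
    | cons x l ih =>
      intro e o r d
      have h := ih (x :: e) (o ++ [decide (some x = b)]) r (d + 1)
      refine (ExecIn.loop_cons (b := x) (l := l)
        (s₁ := regs l 0 (r + l.length) (d + 1) (x :: e) (o ++ [decide (some x = b)]) [])
        (T₁ := 0 + (0 + (0 + 0))) (T₂ := l.length + 1) rfl ?_ ?_).mono (by simp)
      · rw [update_regs_inp, List.length_cons, ← add_assoc]
        cases x
        · exact (lit_exec ..).seq ((push_tmp ..).seq ((drop_todo ..).seq (push_done ..)))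
        · exact (lit_exec ..).seq ((push_tmp ..).seq ((drop_todo ..).seq (push_done ..)))
      · convert h using 2
        · simp; omega
        · simp
        · simp
  have h1 := key w [] o (M - w.length) 0
  rw [Nat.sub_add_cancel hM] at h1
  have h2 := ExecIn.loop_unary (k := .todo) (T := 0)
    (p := StackProg.seq (lit [decide (none = b)]) (push .done true))
    (fun i => regs [] 0 i (w.length + (M - w.length - i)) w.reverse
      (o ++ (w.map (fun x => decide (some x = b)) ++
        List.replicate (M - w.length - i) (decide (none = b)))) []) (M - w.length)
    (fun i _ => rfl) (fun i hi => by
      rw [update_regs_todo]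
      have := (lit_exec [decide (none = b)] [] 0 i (w.length + (M - w.length - (i + 1))) w.reverse
        (o ++ (w.map (fun x => decide (some x = b)) ++
          List.replicate (M - w.length - (i + 1)) (decide (none = b)))) []).seq (push_done ..)
      rwa [List.append_assoc, List.append_assoc, ← List.replicate_succ', add_assoc,
        show M - w.length - (i + 1) + 1 = M - w.length - i by omega] at this)
  simp only [Nat.sub_self, Nat.sub_zero, add_zero, List.replicate_zero, List.append_nil] at h2
  rw [show w.length + (M - w.length) = M by omega] at h2
  have h3 := restoreTodo_exec [] 0 0 M w.reverse (o ++ ((List.range M).map fun i =>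
    decide (w[i]? = b))) []
  have h4 := restoreInp_exec [] 0 M 0 w.reverse (o ++ ((List.range M).map fun i =>
    decide (w[i]? = b))) []
  rw [← hl] at h2
  simp only [List.reverse_reverse, List.append_nil, zero_add] at h1 h3 h4
  exact (h1.seq (h2.seq (h3.seq h4))).mono (by simp; omega)

/-- Compute the size parameter, run `p`, and move what it wrote to the output stack. -/
def writer (a D : ℕ) (p : StackProg Reg) : StackProg Reg :=
  seq (power a D) (seq p (seq (loop .todo skip skip) (seq (loop .inp skip skip)
    (loop .rev (push .out true) (push .out false)))))

theorem writer_exec {a D : ℕ} (ha : 1 ≤ a) {p : StackProg Reg} {w l : List Bool} {T : ℕ}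
    (h : Emits p w ((w.length + a) ^ D) 0 l T) :
    ExecIn (writer a D p) (regs w 0 0 0 [] [] []) (regs [] 0 0 0 [] [] l)
      (4 * w.length + 6 + D * ((w.length + a) ^ D * (2 * w.length + 4) + 2) + (w.length + a) ^ D +
        2 * T) := by
  have h1 := power_exec a D ha w
  have h2 := h.2 []
  have h3 : ExecIn (loop .todo skip skip) (regs w 0 ((w.length + a) ^ D) 0 [] ([] ++ l) [])
      (regs w 0 0 0 [] ([] ++ l) []) ((w.length + a) ^ D * (0 + 1) + 1) :=
    ExecIn.loop_unary (fun i => regs w 0 i 0 [] ([] ++ l) []) _ (fun i _ => rfl)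
      (fun i hi => by rw [update_regs_todo]; exact ExecIn.skip _)
  have h4 : ∀ v : List Bool, ExecIn (loop .inp skip skip) (regs v 0 0 0 [] ([] ++ l) [])
      (regs [] 0 0 0 [] ([] ++ l) []) (v.length + 1) := by
    intro v
    induction v with
    | nil => exact ExecIn.loop_nil _ _ rfl
    | cons b v ih =>
      refine ExecIn.mono (ExecIn.loop_cons (k := .inp) (s := regs (b :: v) 0 0 0 [] ([] ++ l) [])
        (b := b) (l := v) (T₁ := 0) (T₂ := v.length + 1) rfl ?_ ih) (by simp)
      rw [update_regs_inp]
      cases b <;> exact ExecIn.skip _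
  have h5 : ∀ o out : List Bool, ExecIn (loop .rev (push .out true) (push .out false))
      (regs [] 0 0 0 [] o.reverse out) (regs [] 0 0 0 [] [] (o.reverse ++ out)) (o.length + 1) := by
    intro o
    induction o with
    | nil => exact fun out => ExecIn.loop_nil _ _ rfl
    | cons b o ih =>
      intro out
      have hr := ih (b :: out)
      have hu : Function.update (regs [] 0 0 0 [] (b :: o).reverse out) .rev o =
          regs [] 0 0 0 [] o.reverse out := by
        funext k; cases k <;> simp [regs]
      refine (ExecIn.loop_cons (b := b) (l := o) (T₁ := 0) (T₂ := o.length + 1)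
        (s₁ := regs [] 0 0 0 [] o.reverse (b :: out)) (by simp [regs]) ?_ ?_).mono (by simp)
      · rw [hu]
        cases b <;> exact push_out ..
      · simpa using hr
  have h6 := h5 l.reverse []
  simp only [List.reverse_reverse, List.append_nil, List.length_reverse] at h6
  refine (h1.seq (h2.seq (h3.seq ((h4 w).seq h6)))).mono ?_
  have := h.1
  omega

end StackProg

/-! ### Uniform planning problems -/

/-- A parametrized action over the families of fluents `Φ`, with one instance for each `j < M`:
whether the `i`-th fluent of the family `φ` belongs to the precondition, the add list or the delete
list depends on `φ` and on how `i` compares to `j`. The action always emits the observation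
`letter`. -/
structure Template (Φ L : Type) where
  letter : L
  pre : Φ → Ordering → Bool
  add : Φ → Ordering → Bool
  delete : Φ → Ordering → Bool

/-- A planning problem that is given uniformly in a size parameter `M`: there are `M` fluents in
each family, and `M` actions for each template. -/
structure Schema (Φ L : Type) where
  /-- the templates of the actions -/
  templates : List (Template Φ L)
  /-- The initial values in a family: `.inl b` if they are all `b`, and `.inr b` if the `i`-th
  fluent says whether the `i`-th bit of the input is `b`, where `b = none` means that there is no
  such bit. -/
  init : Φ → Bool ⊕ Option Bool
  /-- the true goal -/
  goal : Φ → Option Bool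
  /-- the other goal -/
  other : Φ → Option Bool
  /-- the part of the initial state that is visible to the observer -/
  start : Φ → Option Bool
  /-- the observation before any action, if the visible part of the state is as in `start` -/
  startObs : L
  /-- the observation before any action, otherwise -/
  otherObs : L

namespace Schema

variable {Φ L : Type} [Fintype Φ] [Fintype L]

/-- The family of a fluent. -/
noncomputable def family {M : ℕ} (x : Fin (Fintype.card Φ * M)) : Φ :=
  (Fintype.equivFin Φ).symm (finProdFinEquiv.symm x).1

/-- The position of a fluent in its family. -/
def position {M N : ℕ} (x : Fin (N * M)) : Fin M := (finProdFinEquiv.symm x).2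

/-- The fluent at a position of a family. -/
noncomputable def fluent {M : ℕ} (φ : Φ) (i : Fin M) : Fin (Fintype.card Φ * M) :=
  finProdFinEquiv (Fintype.equivFin Φ φ, i)

@[simp]
theorem family_fluent {M : ℕ} (φ : Φ) (i : Fin M) : family (fluent φ i) = φ := by
  simp [family, fluent]

@[simp]
theorem position_fluent {M : ℕ} (φ : Φ) (i : Fin M) : position (fluent φ i) = i := by
  simp [position, fluent]

@[simp]
theorem fluent_family {M : ℕ} (x : Fin (Fintype.card Φ * M)) :
    fluent (family x) (position x) = x := by
  rw [fluent, family, position, Equiv.apply_symm_apply, Prod.mk.eta, Equiv.apply_symm_apply]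

/-- The initial value of the `i`-th fluent of the family `φ`, on input `w`. -/
def initValue (S : Schema Φ L) (w : List Bool) (φ : Φ) (i : ℕ) : Bool :=
  match S.init φ with
  | .inl b => b
  | .inr b => decide (w[i]? = b)

/-- The template of an action. -/
def template (S : Schema Φ L) {M : ℕ} (a : Fin (S.templates.length * M)) : Template Φ L :=
  S.templates.get (finProdFinEquiv.symm a).1

/-- The actions: the template number `k` with parameter `j` is the action number `k * M + j`. -/
noncomputable def action (S : Schema Φ L) {M : ℕ} (a : Fin (S.templates.length * M)) :
    PlanAction (Fintype.card Φ * M) where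
  pre := {x | (S.template a).pre (family x) (compare (position x) (position a)) = true}
  add := {x | (S.template a).add (family x) (compare (position x) (position a)) = true}
  delete := {x | (S.template a).delete (family x) (compare (position x) (position a)) = true}
  cost := 0

/-- The planning problem with size parameter `M`, on input `w`. -/
noncomputable def problem (S : Schema Φ L) (M : ℕ) (w : List Bool) : COProblem where
  nFluents := Fintype.card Φ * M
  nActions := S.templates.length * M
  nObs := Fintype.card L
  action := S.action
  init x := S.initValue w (family x) (position x)
  trueGoal x := S.goal (family x)
  otherGoals := [fun x => S.other (family x)]
  initSensor :=
    { rules := [(fun x => S.start (family x), Fintype.equivFin L S.startObs)]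
      default := Fintype.equivFin L S.otherObs }
  sensor a := { rules := [], default := Fintype.equivFin L (S.template a).letter }

end Schema

/-! ### Uniform planning problems can be written down in polynomial time -/

theorem encFun_mul {α : Type} {m n : ℕ} (e : α → List Bool) (f : Fin (m * n) → α) :
    encFun e f =
      (List.ofFn fun i : Fin m =>
        encFun e fun j : Fin n => f (finProdFinEquiv (i, j))).flatten := by
  unfold encFun
  rw [List.ofFn_mul, List.flatten_flatten, List.map_ofFn]
  congr 1
  refine congrArg List.ofFn (funext fun i => ?_)
  simp only [Function.comp]
  congr 1
  refine congrArg List.ofFn (funext fun j => ?_)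
  congr 2
  apply Fin.ext
  simp [finProdFinEquiv, Nat.mul_comm, Nat.add_comm]

theorem ofFn_eq_map_range {α : Type} {n : ℕ} (f : ℕ → α) :
    (List.ofFn fun i : Fin n => f i) = (List.range n).map f :=
  List.ext_getElem (by simp) (by simp)

theorem encFun_range {α : Type} {n : ℕ} (e : α → List Bool) (f : ℕ → α) :
    encFun e (fun i : Fin n => f i) = (List.range n).flatMap fun i => e (f i) := by
  rw [encFun, ofFn_eq_map_range fun i => e (f i), List.flatMap_def]

namespace Schema

open StackProg

variable {Φ L : Type} [Fintype Φ] [Fintype L]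

/-- The families, in the order of the fluents. -/
noncomputable def families (Φ : Type) [Fintype Φ] : List Φ := List.ofFn (Fintype.equivFin Φ).symm

theorem encFun_family {α : Type} {M : ℕ} (e : α → List Bool) (f : Φ → ℕ → α) :
    encFun e (fun x : Fin (Fintype.card Φ * M) => f (family x) (position x)) =
      (families Φ).flatMap fun φ => (List.range M).flatMap fun i => e (f φ i) := by
  rw [encFun_mul, List.flatMap_def, families, List.map_ofFn]
  simp only [family, position, Equiv.symm_apply_apply]
  congr 1
  exact congrArg List.ofFn (funext fun i => encFun_range e _)

omit [Fintype Φ] [Fintype L] in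
theorem encFun_template {α : Type} {M : ℕ} (S : Schema Φ L) (e : α → List Bool)
    (f : Template Φ L → ℕ → α) :
    encFun e (fun a : Fin (S.templates.length * M) => f (S.template a) (position a)) =
      S.templates.flatMap fun t => (List.range M).flatMap fun j => e (f t j) := by
  have h : S.templates.flatMap (fun t => (List.range M).flatMap fun j => e (f t j)) =
      (List.ofFn S.templates.get).flatMap fun t => (List.range M).flatMap fun j => e (f t j) := by
    rw [List.ofFn_get]
  rw [encFun_mul, h, List.flatMap_def, List.map_ofFn]
  simp only [template, position, Equiv.symm_apply_apply]
  congr 1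
  exact congrArg List.ofFn (funext fun i => encFun_range e _)

/-- Write a bit vector that is given by an entry of a template. -/
noncomputable def vecProg (g : Φ → Ordering → Bool) : StackProg Reg :=
  seqs ((families Φ).map fun φ => threeWay (g φ .lt) (g φ .eq) (g φ .gt))

/-- The bit vector that is given by an entry of a template. -/
noncomputable def vec (M : ℕ) (g : Φ → Ordering → Bool) (j : ℕ) : List Bool :=
  (families Φ).flatMap fun φ => (List.range M).flatMap fun i => [g φ (compare i j)]

theorem emits_vecProg (g : Φ → Ordering → Bool) (w : List Bool) (r d : ℕ) :
    Emits (vecProg g) w r d (vec (r + d + 1) g d) ((families Φ).length * (2 * (r + d) + 5)) := by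
  refine emits_flatMap _ fun φ _ => ?_
  convert emits_threeWay (g φ .lt) (g φ .eq) (g φ .gt) w r d using 1
  rw [← List.map_eq_flatMap]
  apply List.ext_getElem
  · simp; omega
  · intro i h1 h2
    rcases lt_trichotomy i d with h | h | h
    · simp [List.getElem_append_left, h, compare_lt_iff_lt.2 h]
    · subst h; simp
    · have h3 : i - d ≠ 0 := by omega
      rw [List.getElem_append_right (by simp; omega)]
      simp [compare_gt_iff_gt.2 h, List.getElem_cons, h3]

/-- Write `l` once for each fluent of a family. -/
def each (l : List Bool) : StackProg Reg := rows (lit l)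

theorem emits_each (l w : List Bool) (M : ℕ) :
    Emits (each l) w M 0 ((List.range M).flatMap fun _ => l) (M * (l.length + 2) + 2) :=
  emits_rows fun r d _ => emits_lit l w r d

/-- Write a unary number that is proportional to the size parameter. -/
def numProg (k : ℕ) : StackProg Reg := seq (each (List.replicate k true)) (lit [false])

theorem emits_numProg (k : ℕ) (w : List Bool) (M : ℕ) :
    Emits (numProg k) w M 0 (encNat (k * M)) (M * (k + 2) + 3) := by
  have e : ((List.range M).flatMap fun _ => List.replicate k true) =
      List.replicate (k * M) true := by
    induction M with
    | zero => simp
    | succ M ih =>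
      rw [List.range_succ, List.flatMap_append, ih, Nat.mul_succ, List.replicate_add]
      simp
  have h := (emits_each (List.replicate k true) w M).seq (emits_lit [false] w M 0)
  rw [e] at h
  exact h.mono (by simp)

/-- The bits of an entry of a partial state. -/
def optBits (x : Option Bool) : List Bool := [x.isSome, x.getD false]

/-- Write a partial state. -/
noncomputable def partialProg (g : Φ → Option Bool) : StackProg Reg :=
  seqs ((families Φ).map fun φ => each (optBits (g φ)))

theorem emits_partialProg (g : Φ → Option Bool) (w : List Bool) (M : ℕ) :
    Emits (partialProg g) w M 0
      (encPartialState fun x : Fin (Fintype.card Φ * M) => g (family x))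
      ((families Φ).length * (M * 4 + 2)) := by
  have h : encPartialState (fun x : Fin (Fintype.card Φ * M) => g (family x)) = _ :=
    encFun_family optBits (fun φ _ => g φ)
  rw [h]
  exact emits_flatMap _ fun φ _ => emits_each ..

/-- Write the actions. -/
noncomputable def actionsProg (S : Schema Φ L) : StackProg Reg :=
  seqs (S.templates.map fun t =>
    rows (seq (vecProg t.pre) (seq (vecProg t.add) (seq (vecProg t.delete) (lit [false])))))

theorem emits_actionsProg (S : Schema Φ L) (w : List Bool) (M : ℕ) :
    Emits S.actionsProg w M 0 (encFun encAction (S.problem M w).action)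
      (S.templates.length * (M * (3 * ((families Φ).length * (2 * M + 5)) + 3) + 2)) := by
  have key : ∀ (j : ℕ) (t : Template Φ L) (g : Φ → Ordering → Bool),
      encFinset ({x | g (family x) (compare (position x : ℕ) j) = true} :
        Finset (Fin (Fintype.card Φ * M))) = vec M g j := by
    intro j t g
    simp only [encFinset, Finset.mem_filter, Finset.mem_univ, true_and, Bool.decide_eq_true]
    exact encFun_family (fun b : Bool => [b]) (fun φ i => g φ (compare i j))
  have h : encFun encAction (S.problem M w).action = S.templates.flatMap fun t =>
      (List.range M).flatMap fun j =>
        vec M t.pre j ++ (vec M t.add j ++ (vec M t.delete j ++ [false])) := by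
    refine Eq.trans ?_ (S.encFun_template id fun t j =>
      vec M t.pre j ++ (vec M t.add j ++ (vec M t.delete j ++ [false])))
    unfold encFun
    congr 1
    refine congrArg List.ofFn (funext fun a => ?_)
    simp only [encAction, problem, action, id]
    rw [← key _ (S.template a), ← key _ (S.template a), ← key _ (S.template a)]
    rfl
  rw [h]
  refine emits_flatMap _ fun t _ => (emits_rows (T := 3 * ((families Φ).length * (2 * M + 5)) + 1)
    fun r d hM => ?_)
  have h1 := (emits_vecProg t.pre w r d).seq ((emits_vecProg t.add w r d).seq
    ((emits_vecProg t.delete w r d).seq (emits_lit [false] w r d)))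
  rw [hM] at h1
  refine h1.mono ?_
  have : (families Φ).length * (2 * (r + d) + 5) ≤ (families Φ).length * (2 * M + 5) :=
    Nat.mul_le_mul_left _ (by omega)
  simp only [List.length_singleton]
  omega

/-- Write the initial state. -/
noncomputable def initProg (S : Schema Φ L) : StackProg Reg :=
  seqs ((families Φ).map fun φ =>
    match S.init φ with
    | .inl b => each [b]
    | .inr b => inputRow b)

theorem emits_initProg (S : Schema Φ L) (w : List Bool) (M : ℕ) (hM : w.length ≤ M) :
    Emits S.initProg w M 0 (encState (S.problem M w).init)
      ((families Φ).length * (3 * M + 4)) := by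
  have h : encState (S.problem M w).init = _ :=
    encFun_family (fun b : Bool => [b]) (fun φ i => S.initValue w φ i)
  rw [h]
  refine emits_flatMap _ fun φ _ => ?_
  unfold initValue
  rcases S.init φ with b | b
  · exact (emits_each [b] w M).mono (by simp; omega)
  · rw [← List.map_eq_flatMap]
    exact emits_inputRow b w M hM

/-- Write the sensor of the initial observation. -/
noncomputable def initSensorProg (S : Schema Φ L) : StackProg Reg :=
  seq (lit [true]) (seq (partialProg S.start)
    (lit (encNat (Fintype.equivFin L S.startObs).val ++
      (false :: encNat (Fintype.equivFin L S.otherObs).val))))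

theorem emits_initSensorProg (S : Schema Φ L) (w : List Bool) (M : ℕ) :
    Emits S.initSensorProg w M 0 (encSensor (S.problem M w).initSensor)
      ((families Φ).length * (M * 4 + 2) + (2 * Fintype.card L + 4)) := by
  have h := (emits_lit [true] w M 0).seq ((emits_partialProg S.start w M).seq
    (emits_lit (encNat (Fintype.equivFin L S.startObs).val ++
      (false :: encNat (Fintype.equivFin L S.otherObs).val)) w M 0))
  have e : encSensor (S.problem M w).initSensor = [true] ++
      (encPartialState (fun x : Fin (Fintype.card Φ * M) => S.start (family x)) ++
        (encNat (Fintype.equivFin L S.startObs).val ++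
          (false :: encNat (Fintype.equivFin L S.otherObs).val))) := by
    simp [encSensor, problem, encList]
  rw [e]
  refine h.mono ?_
  have h1 := (Fintype.equivFin L S.startObs).isLt
  have h2 := (Fintype.equivFin L S.otherObs).isLt
  simp [encNat]
  omega

/-- Write the sensors of the actions. -/
noncomputable def sensorsProg (S : Schema Φ L) : StackProg Reg :=
  seqs (S.templates.map fun t => each (false :: encNat (Fintype.equivFin L t.letter).val))

theorem emits_sensorsProg (S : Schema Φ L) (w : List Bool) (M : ℕ) :
    Emits S.sensorsProg w M 0 (encFun encSensor (S.problem M w).sensor)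
      (S.templates.length * (M * (Fintype.card L + 4) + 2)) := by
  have h : encFun encSensor (S.problem M w).sensor = _ :=
    S.encFun_template (fun r : Sensor (Fintype.card Φ * M) (Fintype.card L) => encSensor r)
      fun t _ => { rules := [], default := Fintype.equivFin L t.letter }
  rw [h]
  refine emits_flatMap _ fun t _ => (emits_each _ w M).mono ?_
  have := (Fintype.equivFin L t.letter).isLt
  have : M * ((false :: encNat (Fintype.equivFin L t.letter).val).length + 2) ≤
      M * (Fintype.card L + 4) := Nat.mul_le_mul_left _ (by
        simp only [encNat, List.length_cons, List.length_append, List.length_replicate,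
          List.length_nil]
        omega)
  omega

/-- Write the whole planning problem. -/
noncomputable def problemProg (S : Schema Φ L) : StackProg Reg :=
  seq (numProg (Fintype.card Φ)) (seq (numProg S.templates.length)
    (seq (lit (encNat (Fintype.card L))) (seq S.actionsProg (seq S.initProg
      (seq (partialProg S.goal) (seq (seq (lit [true]) (seq (partialProg S.other) (lit [false])))
        (seq S.initSensorProg S.sensorsProg)))))))

/-- A bound on the running time of `problemProg`. -/
noncomputable def problemTime (S : Schema Φ L) : Polynomial ℕ :=
  let M : Polynomial ℕ := .X
  let F : Polynomial ℕ := .C (families Φ).length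
  let A : Polynomial ℕ := .C S.templates.length
  let O : Polynomial ℕ := .C (Fintype.card L)
  let N : Polynomial ℕ := .C (Fintype.card Φ)
  (M * (N + 2) + 3) + (M * (A + 2) + 3) + (O + 1) + A * (M * (3 * (F * (2 * M + 5)) + 3) + 2) +
    F * (3 * M + 4) + F * (M * 4 + 2) + (F * (M * 4 + 2) + 2) + (F * (M * 4 + 2) + (2 * O + 4)) +
    A * (M * (O + 4) + 2)

theorem emits_problemProg (S : Schema Φ L) (w : List Bool) (M : ℕ) (hM : w.length ≤ M) :
    Emits S.problemProg w M 0 (encProblem (S.problem M w)) (S.problemTime.eval M) := by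
  have h := (emits_numProg (Fintype.card Φ) w M).seq ((emits_numProg S.templates.length w M).seq
    ((emits_lit (encNat (Fintype.card L)) w M 0).seq ((S.emits_actionsProg w M).seq
      ((S.emits_initProg w M hM).seq ((emits_partialProg S.goal w M).seq
        (((emits_lit [true] w M 0).seq ((emits_partialProg S.other w M).seq
          (emits_lit [false] w M 0))).seq
            ((S.emits_initSensorProg w M).seq (S.emits_sensorsProg w M))))))))
  have e : encProblem (S.problem M w) = encNat (Fintype.card Φ * M) ++
      (encNat (S.templates.length * M) ++ (encNat (Fintype.card L) ++
        (encFun encAction (S.problem M w).action ++ (encState (S.problem M w).init ++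
          (encPartialState (fun x : Fin (Fintype.card Φ * M) => S.goal (family x)) ++
            (([true] ++ (encPartialState (fun x : Fin (Fintype.card Φ * M) =>
              S.other (family x)) ++ [false])) ++ (encSensor (S.problem M w).initSensor ++
                encFun encSensor (S.problem M w).sensor))))))) := by
    simp only [encProblem]
    rfl
  rw [e]
  refine h.mono ?_
  simp only [problemTime, Polynomial.eval_add, Polynomial.eval_mul, Polynomial.eval_C,
    Polynomial.eval_X, Polynomial.eval_ofNat, Polynomial.eval_one, List.length_singleton]
  simp only [encNat, List.length_append, List.length_replicate, List.length_singleton]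
  omega

/-- The map from `w` to an encoding of the planning problem on input `w`, with a size parameter that
is polynomial in the length of `w`, is computable in polynomial time. -/
theorem computable (S : Schema Φ L) {a D : ℕ} (ha : 1 ≤ a) (hD : 1 ≤ D) (pre : List Bool)
    {α : Type} {enc : α → List Bool} {f : List Bool → α}
    (hf : ∀ w, enc (f w) = pre ++ encProblem (S.problem ((w.length + a) ^ D) w)) :
    Nonempty (Turing.TM2ComputableInPolyTime (id : List Bool → List Bool) enc f) := by
  let N : Polynomial ℕ := .X
  let M : Polynomial ℕ := (N + .C a) ^ D
  refine computableInPolyTime (writer a D (seq (lit pre) S.problemProg)) Reg.inp Reg.out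
    (4 * N + 6 + .C D * (M * (2 * N + 4) + 2) + M + 2 * (.C pre.length + S.problemTime.comp M))
    fun w => ?_
  have hM : w.length ≤ (w.length + a) ^ D :=
    (Nat.le_add_right _ _).trans (Nat.le_self_pow (by omega) _)
  have h := writer_exec ha ((emits_lit pre w ((w.length + a) ^ D) 0).seq
    (S.emits_problemProg w _ hM))
  rw [← hf] at h
  have e1 : regs w 0 0 0 [] [] [] = Function.update (fun _ => []) Reg.inp w := by
    funext k; cases k <;> rfl
  have e2 : regs [] 0 0 0 [] [] (enc (f w)) =
      Function.update (fun _ => []) Reg.out (enc (f w)) := by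
    funext k; cases k <;> rfl
  rw [e1, e2] at h
  refine h.mono (le_of_eq ?_)
  simp [N, M, Polynomial.eval_comp]

end Schema

/-! ### Binary counters -/

/-- Binary increment: if `j` is the lowest bit `0` of `h`, then `h + 1` arises from `h` by flipping
the bits up to `j`. -/
theorem testBit_add_one : ∀ (j h : ℕ), (∀ i < j, h.testBit i = true) → h.testBit j = false →
    ∀ i, (h + 1).testBit i = if i < j then false else if i = j then true else h.testBit i := by
  intro j
  induction j with
  | zero =>
    intro h _ h2 i
    rw [Nat.testBit_zero] at h2
    cases i with
    | zero => simp at *; omega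
    | succ i =>
      have : (h + 1) / 2 = h / 2 := by simp at h2; omega
      simp [Nat.testBit_succ, this]
  | succ j ih =>
    intro h h1 h2 i
    have h0 := h1 0 (by omega)
    rw [Nat.testBit_zero] at h0
    simp at h0
    have e : (h + 1) / 2 = h / 2 + 1 := by omega
    have := ih (h / 2) (fun i hi => by rw [← Nat.testBit_succ]; exact h1 _ (by omega))
      (by rw [← Nat.testBit_succ]; exact h2)
    cases i with
    | zero => simp; omega
    | succ i => rw [Nat.testBit_succ, e, this]; simp [Nat.testBit_succ]

/-- Binary decrement: if `j` is the lowest bit `1` of `h`, then `h - 1` arises from `h` by flipping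
the bits up to `j`. -/
theorem testBit_sub_one : ∀ (j h : ℕ), (∀ i < j, h.testBit i = false) → h.testBit j = true →
    0 < h ∧ ∀ i, (h - 1).testBit i =
      if i < j then true else if i = j then false else h.testBit i := by
  intro j
  induction j with
  | zero =>
    intro h _ h2
    rw [Nat.testBit_zero] at h2
    simp at h2
    refine ⟨by omega, fun i => ?_⟩
    cases i with
    | zero => simp; omega
    | succ i =>
      have : (h - 1) / 2 = h / 2 := by omega
      simp [Nat.testBit_succ, this]
  | succ j ih =>
    intro h h1 h2
    have h0 := h1 0 (by omega)
    rw [Nat.testBit_zero] at h0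
    simp at h0
    obtain ⟨hp, this⟩ := ih (h / 2) (fun i hi => by rw [← Nat.testBit_succ]; exact h1 _ (by omega))
      (by rw [← Nat.testBit_succ]; exact h2)
    have e : (h - 1) / 2 = h / 2 - 1 := by omega
    refine ⟨by omega, fun i => ?_⟩
    cases i with
    | zero => simp; omega
    | succ i => rw [Nat.testBit_succ, e, this]; simp [Nat.testBit_succ]

/-- A number that can be incremented without overflow has a bit `0` among its `M` bits. -/
theorem exists_lowest_zero {M h : ℕ} (hh : h + 1 < 2 ^ M) :
    ∃ j < M, (∀ i < j, h.testBit i = true) ∧ h.testBit j = false := by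
  classical
  have hex : ∃ j, h.testBit j = false := ⟨M, Nat.testBit_lt_two_pow (by omega)⟩
  refine ⟨Nat.find hex, ?_, fun i hi => by simpa using Nat.find_min hex hi, Nat.find_spec hex⟩
  by_contra hM
  have : h = 2 ^ M - 1 := by
    apply Nat.eq_of_testBit_eq
    intro i
    rw [Nat.testBit_two_pow_sub_one]
    by_cases hi : i < M
    · simpa [hi] using Nat.find_min hex (lt_of_lt_of_le hi (not_lt.1 hM))
    · simp only [hi, decide_false]
      exact Nat.testBit_lt_two_pow (lt_of_lt_of_le (by omega : h < 2 ^ M)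
        (Nat.pow_le_pow_right (by omega) (not_lt.1 hi)))
  omega

theorem exists_lowest_one {M h : ℕ} (h0 : 0 < h) (hh : h < 2 ^ M) :
    ∃ j < M, (∀ i < j, h.testBit i = false) ∧ h.testBit j = true := by
  classical
  have hex : ∃ j, h.testBit j = true := Nat.exists_testBit_of_ne_zero h0.ne'
  refine ⟨Nat.find hex, ?_, fun i hi => by simpa using Nat.find_min hex hi, Nat.find_spec hex⟩
  have h1 := Nat.ge_two_pow_of_testBit (Nat.find_spec hex)
  exact (Nat.pow_lt_pow_iff_right (by omega : 1 < 2)).1 (lt_of_le_of_lt h1 hh)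

theorem succ_lt_two_pow {M h j : ℕ} (hh : h < 2 ^ M) (hj : j < M) (hb : h.testBit j = false) :
    h + 1 < 2 ^ M := by
  by_contra hn
  have : h = 2 ^ M - 1 := by omega
  rw [this, Nat.testBit_two_pow_sub_one] at hb
  simp [hj] at hb

/-! ### Uniform planning problems: transitions and beliefs -/

namespace Template

variable {Φ L : Type} [Fintype Φ]

/-- The `j`-th action of the template leads from `s` to `s'`. -/
def Fires (t : Template Φ L) {M : ℕ} (j : Fin M) (s s' : State (Fintype.card Φ * M)) : Prop :=
  (∀ φ i, t.pre φ (compare i j) = true → s (Schema.fluent φ i) = true) ∧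
    ∀ φ i, s' (Schema.fluent φ i) =
      ((s (Schema.fluent φ i) || t.add φ (compare i j)) && !t.delete φ (compare i j))

theorem exists_fires (t : Template Φ L) {M : ℕ} (j : Fin M) (s : State (Fintype.card Φ * M))
    (h : ∀ φ i, t.pre φ (compare i j) = true → s (Schema.fluent φ i) = true) :
    ∃ s', t.Fires j s s' :=
  ⟨fun x => (s x || t.add (Schema.family x) (compare (Schema.position x) j)) &&
    !t.delete (Schema.family x) (compare (Schema.position x) j), h, fun φ i => by simp⟩

end Template

namespace Schema

variable {Φ L : Type} [Fintype Φ] [Fintype L]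

theorem step_eq_some (S : Schema Φ L) {M : ℕ} {w : List Bool} {s s' : State (Fintype.card Φ * M)}
    {a : Fin (S.templates.length * M)} :
    (S.problem M w).step s a = some s' ↔ (S.template a).Fires (position a) s s' := by
  have h1 : (∀ i ∈ (S.action a).pre, s i = true) ↔
      ∀ φ i, (S.template a).pre φ (compare i (position a)) = true → s (fluent φ i) = true := by
    constructor
    · intro h φ i hi
      exact h _ (by simpa [action] using hi)
    · intro h x hx
      have := h (family x) (position x) (by simpa [action] using hx)
      simpa using this
  have h2 : (fun x => (s x || decide (x ∈ (S.action a).add)) &&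
        !decide (x ∈ (S.action a).delete)) = s' ↔
      ∀ φ i, s' (fluent φ i) = ((s (fluent φ i) ||
        (S.template a).add φ (compare i (position a))) &&
          !(S.template a).delete φ (compare i (position a))) := by
    constructor
    · rintro rfl φ i
      simp [action]
    · intro h
      funext x
      have := h (family x) (position x)
      rw [fluent_family] at this
      rw [this]
      simp [action]
  change (S.action a).apply s = some s' ↔ _
  unfold PlanAction.apply Template.Fires
  rw [← h1, ← h2]
  by_cases hp : ∀ i ∈ (S.action a).pre, s i = true
  · rw [if_pos hp, Option.some_inj]
    exact ⟨fun h => ⟨hp, h⟩, fun h => h.2⟩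
  · rw [if_neg hp]
    exact ⟨fun h => by simp at h, fun h => absurd h.1 hp⟩

/-- The observation with the letter `ℓ`. -/
noncomputable def letterObs (S : Schema Φ L) (M : ℕ) (w : List Bool) (ℓ : L) :
    Fin (S.problem M w).nObs := Fintype.equivFin L ℓ

theorem letterObs_surjective (S : Schema Φ L) (M : ℕ) (w : List Bool) :
    Function.Surjective (S.letterObs M w) := (Fintype.equivFin L).surjective

omit [Fintype Φ] [Fintype L] in
theorem exists_action (S : Schema Φ L) {M : ℕ} {t : Template Φ L} (ht : t ∈ S.templates)
    (j : Fin M) : ∃ a : Fin (S.templates.length * M), S.template a = t ∧ position a = j := by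
  obtain ⟨i, rfl⟩ := List.mem_iff_get.1 ht
  exact ⟨finProdFinEquiv (i, j), by simp only [template, Equiv.symm_apply_apply],
    by simp only [position, Equiv.symm_apply_apply]⟩

omit [Fintype Φ] [Fintype L] in
theorem template_mem (S : Schema Φ L) {M : ℕ} (a : Fin (S.templates.length * M)) :
    S.template a ∈ S.templates := List.get_mem ..

theorem mem_update (S : Schema Φ L) {M : ℕ} {w : List Bool}
    {b : Set (State (Fintype.card Φ * M))} {ℓ : L} {s' : State (Fintype.card Φ * M)} :
    s' ∈ (S.problem M w).update b (S.letterObs M w ℓ) ↔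
      ∃ s ∈ b, ∃ t ∈ S.templates, t.letter = ℓ ∧ ∃ j, t.Fires j s s' := by
  constructor
  · rintro ⟨s, hs, a, ha, ho⟩
    exact ⟨s, hs, S.template a, S.template_mem a, (Fintype.equivFin L).injective ho, _,
      S.step_eq_some.1 ha⟩
  · rintro ⟨s, hs, t, ht, rfl, j, hf⟩
    obtain ⟨a, rfl, rfl⟩ := S.exists_action ht j
    exact ⟨s, hs, a, S.step_eq_some.2 hf, rfl⟩

/-- The initial belief consists of the states that agree with the initial state on the visible part.
-/
theorem mem_initBelief (S : Schema Φ L) {M : ℕ} {w : List Bool} (hne : S.startObs ≠ S.otherObs)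
    (hS : ∀ φ b, S.start φ = some b → S.init φ = .inl b) {s : State (Fintype.card Φ * M)} :
    s ∈ (S.problem M w).initBelief (S.problem M w).init ↔
      ∀ φ i b, S.start φ = some b → s (fluent φ i) = b := by
  have key : ∀ s : State (Fintype.card Φ * M),
      s.Sat (fun x => S.start (family x)) ↔ ∀ φ i b, S.start φ = some b → s (fluent φ i) = b :=
    fun s => ⟨fun h φ i b hb => h (fluent φ i) b (by simpa using hb), fun h x b hb => by
      simpa using h (family x) (position x) b hb⟩
  have hobs : ∀ s : State (Fintype.card Φ * M), (S.problem M w).obs none s =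
      if s.Sat (fun x => S.start (family x)) then S.letterObs M w S.startObs
      else S.letterObs M w S.otherObs := by
    intro s
    by_cases h : s.Sat (fun x => S.start (family x))
    · simp [COProblem.obs, problem, Sensor.eval, h, letterObs]
    · simp [COProblem.obs, problem, Sensor.eval, List.find?, h, letterObs]
  have hinit : State.Sat (S.problem M w).init (fun x => S.start (family x)) := by
    intro x b hb
    simp [problem, initValue, hS _ _ hb]
  rw [← key]
  change (S.problem M w).obs none s = (S.problem M w).obs none (S.problem M w).init ↔ _
  rw [hobs, (hobs (S.problem M w).init).trans (if_pos hinit)]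
  by_cases h : s.Sat (fun x => S.start (family x))
  · simp [h]
  · simp only [h, if_false, iff_false]
    exact fun he => hne ((Fintype.equivFin L).injective he).symm

end Schema

/-! ### Plans -/

namespace COProblem

theorem run_cons (P : COProblem) {s s' : State P.nFluents} {a : Fin P.nActions}
    {π : List (Fin P.nActions)} :
    P.run s (a :: π) = some s' ↔ ∃ s₁, P.step s a = some s₁ ∧ P.run s₁ π = some s' :=
  Option.bind_eq_some_iff

theorem run_concat (P : COProblem) {s s' s'' : State P.nFluents} {π : List (Fin P.nActions)}
    {a : Fin P.nActions} (h : P.run s π = some s') (ha : P.step s' a = some s'') :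
    P.run s (π ++ [a]) = some s'' ∧
      P.emitted s (π ++ [a]) = P.emitted s π ++ [P.obs (some a) s''] := by
  induction π generalizing s with
  | nil =>
    simp only [run, Option.some.injEq] at h
    subst h
    simp [run, emitted, ha]
  | cons a' π ih =>
    simp only [run, Option.bind_eq_some_iff] at h
    obtain ⟨s₁, h1, h2⟩ := h
    obtain ⟨h3, h4⟩ := ih h2
    simp [run, emitted, h1, h3, h4]

/-- The state that is really reached is possible for the observer. -/
theorem run_mem_foldl (P : COProblem) {s s' : State P.nFluents} {π : List (Fin P.nActions)}
    {b : Set (State P.nFluents)} (hs : s ∈ b) (h : P.run s π = some s') :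
    s' ∈ (P.emitted s π).foldl P.update b := by
  induction π generalizing s b with
  | nil =>
    simp only [run, Option.some.injEq] at h
    subst h
    exact hs
  | cons a π ih =>
    simp only [run, Option.bind_eq_some_iff] at h
    obtain ⟨s₁, h1, h2⟩ := h
    simp only [emitted, h1, List.foldl_cons]
    exact ih ⟨s, hs, a, h1, rfl⟩ h2

/-- A plan that reaches the true goal is `1`-legible exactly if no other goal is possible at its
end, as the true goal is possible. -/
theorem isLegible_one_iff (P : COProblem) (π : List (Fin P.nActions)) :
    P.IsLegible 1 π ↔ P.Reaches π ∧
      ∀ g ∈ P.otherGoals, g ≠ P.trueGoal → ∀ s ∈ P.lastBelief π, ¬ s.Sat g := by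
  have hcard : 1 ≤ P.goals.card := Finset.card_pos.2 ⟨_, Finset.mem_insert_self _ _⟩
  have hfin : (P.goalsIn (P.lastBelief π)).Finite := P.goals.finite_toSet.subset fun g hg => hg.1
  constructor
  · rintro ⟨-, -, hr, hn⟩
    refine ⟨hr, fun g hg hne s hs hsat => hne ?_⟩
    obtain ⟨s', hs', hsat'⟩ := hr
    exact (Set.ncard_le_one hfin).1 hn _
      ⟨Finset.mem_insert_of_mem (List.mem_toFinset.2 hg), s, hs, hsat⟩ _
      ⟨Finset.mem_insert_self _ _, s', P.run_mem_foldl rfl hs', hsat'⟩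
  · rintro ⟨hr, h⟩
    have key : ∀ g ∈ P.goalsIn (P.lastBelief π), g = P.trueGoal := by
      rintro g ⟨hg, s, hs, hsat⟩
      by_contra hne
      have hg' : g ∈ P.otherGoals :=
        List.mem_toFinset.1 ((Finset.mem_insert.1 hg).resolve_left hne)
      exact h g hg' hne s hs hsat
    exact ⟨le_rfl, hcard, hr, (Set.ncard_le_one hfin).2 fun a ha b hb => by
      rw [key a ha, key b hb]⟩

/-- The true goal is possible at the end of every plan that reaches it. -/
theorem IsLegible.isAmbiguous {P : COProblem} {π : List (Fin P.nActions)} (h : P.IsLegible 1 π) :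
    P.IsAmbiguous 1 π := by
  obtain ⟨h1, h2, h3, -⟩ := h
  refine ⟨h1, h2, h3, ?_⟩
  obtain ⟨s, hs, hsat⟩ := h3
  exact (Set.ncard_pos (P.goals.finite_toSet.subset fun g hg => hg.1)).2
    ⟨P.trueGoal, Finset.mem_insert_self _ _, s, P.run_mem_foldl rfl hs, hsat⟩

end COProblem

/-! ### Stack machines -/

/-- The instructions of a stack machine with stacks `K`, symbols `S` and control states `Q`. -/
inductive Instr (K S Q : Type) where
  | push (k : K) (x : S) (q : Q)
  /-- Inspect the top symbol of `k` (`none` if there is none), and remove it if `drop`. -/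
  | read (k : K) (drop : Bool) (f : Option S → Q)
  | jump (q : Q)
  | halt

/-- A machine with several stacks that executes one instruction for each control state. It is a
restricted form of Mathlib's multi-stack machines, in which one step is one stack operation. -/
structure StackMachine (K S Q : Type) where
  instr : Q → Instr K S Q
  /-- the control state at the start -/
  start : Q
  /-- the accepting control state -/
  accept : Q
  /-- the stack that holds the input at the start -/
  inStack : K
  /-- the symbols that stand for the input bits -/
  inSymbol : Bool → S

/-- The letters of the history of a run, with what they claim about the symbols read. -/
inductive Letter (K S : Type) where
  /-- All stacks are empty. -/
  | start
  /-- The stacks do not change. -/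
  | nop
  | push (k : K) (x : S)
  /-- The top symbol of `k` is `x` (and it is removed if `drop`). -/
  | read (k : K) (drop : Bool) (x : Option S)
  deriving Fintype

namespace Letter

variable {K S : Type} [DecidableEq K]

/-- What a letter does to the stacks. -/
def effect : Letter K S → (K → List S) → K → List S
  | push k x, st => Function.update st k (x :: st k)
  | read k true _, st => Function.update st k (st k).tail
  | _, st => st

/-- What a letter claims about the stacks is true. -/
def Truthful : Letter K S → (K → List S) → Prop
  | start, st => ∀ k, st k = []
  | read k _ x, st => (st k).head? = x
  | _, _ => True

/-- The letter does not change the stack `k`. -/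
def Keeps : Letter K S → K → Prop
  | push k' _, k => k' ≠ k
  | read k' true (some _), k => k' ≠ k
  | _, _ => True

/-- The letter puts the symbol `g` on the stack `k`; the value `none` stands for the bottom of the
stack, which is there from the start. -/
inductive Spawns : Letter K S → K → Option S → Prop
  | start (k : K) : Spawns start k none
  | push (k : K) (x : S) : Spawns (push k x) k (some x)

/-- Removing the top of an empty stack does not change it, which is why `read k true none` is among
the letters that keep the stack `k`. -/
theorem Keeps.effect_apply {ℓ : Letter K S} {k : K} (h : ℓ.Keeps k) {st : K → List S}
    (ht : ℓ.Truthful st) : ℓ.effect st k = st k := by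
  match ℓ, h, ht with
  | start, _, _ => rfl
  | nop, _, _ => rfl
  | push k' x, h, _ => exact Function.update_of_ne (Ne.symm h) ..
  | read k' false x, _, _ => rfl
  | read k' true (some x), h, _ => exact Function.update_of_ne (Ne.symm h) ..
  | read k' true none, _, ht =>
    by_cases hk : k = k'
    · subst hk
      have : st k = [] := by simpa [Truthful] using ht
      simp [effect, this]
    · exact Function.update_of_ne hk ..

omit [DecidableEq K] in
theorem eq_of_not_keeps {ℓ : Letter K S} {k : K} (h : ¬ ℓ.Keeps k) :
    (∃ x, ℓ = push k x) ∨ ∃ x, ℓ = read k true (some x) := by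
  match ℓ, h with
  | start, h => exact absurd trivial h
  | nop, h => exact absurd trivial h
  | push k' x, h => exact .inl ⟨x, by rw [not_not.1 h]⟩
  | read k' false x, h => exact absurd trivial h
  | read k' true (some x), h => exact .inr ⟨x, by rw [not_not.1 h]⟩
  | read k' true none, h => exact absurd trivial h

end Letter

/-- The symbol `g` lies on the stack `k` with `h` symbols above it; below the last symbol there is
the bottom `none`. -/
def Tracked {K S : Type} (st : K → List S) (k : K) (h : ℕ) (g : Option S) : Prop :=
  ((st k).map some ++ [none])[h]? = some g

section Tracked

variable {K S : Type} {st st' : K → List S} {k : K} {h : ℕ} {g : Option S} {x : S}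

theorem tracked_zero : Tracked st k 0 g ↔ (st k).head? = g := by
  unfold Tracked
  cases st k <;> simp

theorem tracked_congr (hk : st' k = st k) : Tracked st' k h g ↔ Tracked st k h g := by
  unfold Tracked
  rw [hk]

theorem tracked_push (hk : st' k = x :: st k) : Tracked st' k (h + 1) g ↔ Tracked st k h g := by
  unfold Tracked
  rw [hk]
  simp

theorem Tracked.le_length (ht : Tracked st k h g) : h ≤ (st k).length := by
  obtain ⟨hlt, -⟩ := List.getElem?_eq_some_iff.1 ht
  simp at hlt
  omega

end Tracked

namespace Instr

variable {K S Q : Type}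

/-- The letter and the next control state, if the symbol read is claimed to be `x`. -/
def out : Instr K S Q → Option S → Option (Letter K S × Q)
  | push k x q, _ => some (.push k x, q)
  | read k drop f, x => some (.read k drop x, f x)
  | jump q, _ => some (.nop, q)
  | halt, _ => none

end Instr

namespace StackMachine

variable {K S Q : Type} [DecidableEq K]

/-- One step of a stack machine. -/
inductive Step (A : StackMachine K S Q) : Q × (K → List S) → Q × (K → List S) → Prop
  | mk {q q' : Q} {x : Option S} {ℓ : Letter K S} {st : K → List S}
      (h : (A.instr q).out x = some (ℓ, q')) (ht : ℓ.Truthful st) : Step A (q, st) (q', ℓ.effect st)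

/-- The stacks at the start. -/
def inputStacks (A : StackMachine K S Q) (w : List Bool) : K → List S :=
  Function.update (fun _ => []) A.inStack (w.map A.inSymbol)

/-- The configuration `c` is reached on input `w`. -/
def Reaches (A : StackMachine K S Q) (w : List Bool) (c : Q × (K → List S)) : Prop :=
  Relation.ReflTransGen A.Step (A.start, A.inputStacks w) c

end StackMachine

/-! ### The planning problem of a stack machine -/

/-- What a state of the planning problem does: run the machine, check a symbol `g` of the stack `k`
(the value `none` stands for the bottom of the stack), or report an error. -/
inductive Mode (K S : Type) where
  | main
  | check (k : K) (g : Option S)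
  | error
  deriving Fintype

/-- The control state of the mode `main`: before the first letter, while the input is pushed on its
stack, and during the run of the machine. -/
inductive Control (Q : Type) where
  | start
  | feed
  | run (q : Q)
  deriving Fintype

/-- The families of fluents. -/
inductive Family (K S Q : Type) where
  /-- The mode; all fluents of such a family have the same value. -/
  | mode (m : Mode K S)
  /-- The `i`-th bit of the counter is `b`. -/
  | bit (b : Bool)
  /-- The position `i` of the input is already processed. -/
  | fed
  /-- The `i`-th bit of the input is `b` (or missing), and not yet processed. -/
  | input (b : Option Bool)
  /-- The control state; all fluents of such a family have the same value. -/
  | ctl (c : Control Q)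
  deriving Fintype

namespace StackMachine

variable {K S Q : Type}

open scoped Classical in
/-- A step of the control state from `c` to `c'`. If `wait`, the input has to be processed. -/
noncomputable def ctlTemplate (c : Control Q) (ℓ : Letter K S) (c' : Control Q) (wait : Bool) :
    Template (Family K S Q) (Letter K S) where
  letter := ℓ
  pre φ _ :=
    match φ with
    | .mode m => decide (m = .main)
    | .ctl x => decide (x = c)
    | .fed => wait
    | _ => false
  add φ _ :=
    match φ with
    | .ctl x => decide (x = c')
    | _ => false
  delete φ _ :=
    match φ with
    | .ctl x => decide (x = c ∧ x ≠ c')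
    | _ => false

open scoped Classical in
/-- Processing the bit `b` of the input at the position `j`, the last one not yet processed. -/
noncomputable def inputTemplate (A : StackMachine K S Q) (b : Option Bool) :
    Template (Family K S Q) (Letter K S) where
  letter := b.elim .nop fun x => .push A.inStack (A.inSymbol x)
  pre φ o :=
    match φ with
    | .mode m => decide (m = .main)
    | .ctl x => decide (x = .feed)
    | .fed => decide (o = .gt)
    | .input b' => decide (b' = b ∧ o = .eq)
    | _ => false
  add φ o :=
    match φ with
    | .fed => decide (o = .eq)
    | _ => false
  delete φ o :=
    match φ with
    | .input b' => decide (b' = b ∧ o = .eq)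
    | _ => false

open scoped Classical in
/-- A change of the mode from `m` to `m'`. If `zero`, the counter has to be zero. -/
noncomputable def modeTemplate (m : Mode K S) (ℓ : Letter K S) (m' : Mode K S) (zero : Bool) :
    Template (Family K S Q) (Letter K S) where
  letter := ℓ
  pre φ _ :=
    match φ with
    | .mode x => decide (x = m)
    | .bit b => zero && !b
    | _ => false
  add φ _ :=
    match φ with
    | .mode x => decide (x = m')
    | _ => false
  delete φ _ :=
    match φ with
    | .mode x => decide (x = m ∧ x ≠ m')
    | _ => false

open scoped Classical in
/-- Counting up or down by one in the mode `m`, where `j` is the lowest bit of the counter with the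
value `0` (when counting up) or `1` (when counting down). -/
noncomputable def countTemplate (m : Mode K S) (ℓ : Letter K S) (up : Bool) :
    Template (Family K S Q) (Letter K S) where
  letter := ℓ
  pre φ o :=
    match φ with
    | .mode x => decide (x = m)
    | .bit b => decide ((o = .lt ∧ b = up) ∨ (o = .eq ∧ b = !up))
    | _ => false
  add φ o :=
    match φ with
    | .bit b => decide ((o = .lt ∧ b = !up) ∨ (o = .eq ∧ b = up))
    | _ => false
  delete φ o :=
    match φ with
    | .bit b => decide ((o = .lt ∧ b = up) ∨ (o = .eq ∧ b = !up))
    | _ => false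

/-- The templates of the planning problem. A check of a symbol starts when the symbol is pushed, the
counter holds the number of symbols above it, and the check ends in the mode `error` when the symbol
is on top and another one is claimed to be read. -/
inductive IsTemplate (A : StackMachine K S Q) : Template (Family K S Q) (Letter K S) → Prop
  | begin : IsTemplate A (ctlTemplate .start .start .feed false)
  | input (b : Option Bool) : IsTemplate A (A.inputTemplate b)
  | launch : IsTemplate A (ctlTemplate .feed .nop (.run A.start) true)
  | exec {q q' : Q} {x : Option S} {ℓ : Letter K S} (h : (A.instr q).out x = some (ℓ, q')) :
      IsTemplate A (ctlTemplate (.run q) ℓ (.run q') false)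
  | spawn {ℓ : Letter K S} {k : K} {g : Option S} (h : ℓ.Spawns k g) :
      IsTemplate A (modeTemplate .main ℓ (.check k g) false)
  | keep {ℓ : Letter K S} {k : K} (g : Option S) (h : ℓ.Keeps k) :
      IsTemplate A (modeTemplate (.check k g) ℓ (.check k g) false)
  | up (k : K) (g : Option S) (x : S) :
      IsTemplate A (countTemplate (.check k g) (.push k x) true)
  | down (k : K) (g : Option S) (x : S) :
      IsTemplate A (countTemplate (.check k g) (.read k true (some x)) false)
  | clash {k : K} {g x : Option S} (drop : Bool) (h : x ≠ g) :
      IsTemplate A (modeTemplate (.check k g) (.read k drop x) .error true)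
  | error (ℓ : Letter K S) : IsTemplate A (modeTemplate .error ℓ .error false)

instance {Φ L : Type} [Finite Φ] [Finite L] : Finite (Template Φ L) :=
  Finite.of_injective
    (β := L × (Φ → Ordering → Bool) × (Φ → Ordering → Bool) × (Φ → Ordering → Bool))
    (fun t => (t.letter, t.pre, t.add, t.delete)) fun t t' h => by
      cases t; cases t'; simpa using h

variable [Fintype K] [Fintype S] [Fintype Q]

open scoped Classical in
/-- The planning problem of a stack machine: the true goal is that the machine accepts, the other
goal is that an error was found. -/
noncomputable def schema (A : StackMachine K S Q) : Schema (Family K S Q) (Letter K S) where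
  templates := (Set.toFinite {t | A.IsTemplate t}).toFinset.toList
  init
    | .mode m => .inl (decide (m = .main))
    | .bit b => .inl (!b)
    | .fed => .inl false
    | .input b => .inr b
    | .ctl c => .inl (decide (c = .start))
  goal
    | .mode m => if m = .main then some true else none
    | .ctl c => if c = .run A.accept then some true else none
    | _ => none
  other
    | .mode m => if m = .error then some true else none
    | _ => none
  start
    | .mode m => some (decide (m = .main))
    | .bit b => some (!b)
    | _ => none
  startObs := .start
  otherObs := .nop

theorem mem_templates (A : StackMachine K S Q) {t : Template (Family K S Q) (Letter K S)} :
    t ∈ A.schema.templates ↔ A.IsTemplate t := by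
  simp [schema]

/-- The states of the planning problem with size parameter `M`. -/
abbrev PlanState (K S Q : Type) [Fintype K] [Fintype S] [Fintype Q] (M : ℕ) : Type :=
  State (Fintype.card (Family K S Q) * M)

variable {M : ℕ}

/-- The state has the mode `m`. -/
def HasMode (s : PlanState K S Q M) (m : Mode K S) : Prop :=
  ∀ m' i, s (Schema.fluent (.mode m') i) = true ↔ m' = m

/-- The state has the control state `c`. -/
def HasCtl (s : PlanState K S Q M) (c : Control Q) : Prop :=
  ∀ c' i, s (Schema.fluent (.ctl c') i) = true ↔ c' = c

/-- The counter holds `h`. Both values of a bit have a fluent, since preconditions can only require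
fluents to be true. -/
def HasCount (s : PlanState K S Q M) (h : ℕ) : Prop :=
  ∀ b i, s (Schema.fluent (.bit b) i) = true ↔ h.testBit i = b

/-- The positions of the input `w` from `j` on are processed. -/
def HasFed (w : List Bool) (s : PlanState K S Q M) (j : ℕ) : Prop :=
  (∀ i : Fin M, s (Schema.fluent .fed i) = true ↔ j ≤ i) ∧
    ∀ b, ∀ i : Fin M, s (Schema.fluent (.input b) i) = true ↔ (i : ℕ) < j ∧ w[(i : ℕ)]? = b

omit [Fintype Q] in
/-- There is a fluent that tells the mode, as `0 < M`. -/
theorem HasMode.unique [Fintype Q] (hM : 0 < M) {s : PlanState K S Q M} {m m' : Mode K S}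
    (h : HasMode s m) (h' : HasMode s m') : m = m' :=
  (h' m ⟨0, hM⟩).1 ((h m ⟨0, hM⟩).2 rfl)

theorem _root_.Template.Fires.iff {Φ L : Type} [Fintype Φ] {t : Template Φ L} {j : Fin M}
    {s s' : State (Fintype.card Φ * M)} (h : t.Fires j s s') (φ : Φ) (i : Fin M) :
    s' (Schema.fluent φ i) = true ↔
      (s (Schema.fluent φ i) = true ∨ t.add φ (compare i j) = true) ∧
        t.delete φ (compare i j) = false := by
  rw [h.2]
  simp

section templates

variable {s s' : PlanState K S Q M} {j : Fin M} {m m₀ m' : Mode K S} {ℓ : Letter K S}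

/-- The counter is zero if its `M` bits are zero and it holds a number below `2 ^ M`. -/
theorem modeTemplate_fires {zero : Bool} (hM : 0 < M) (hs : HasMode s m₀)
    (hf : (modeTemplate m ℓ m' zero).Fires j s s') :
    m = m₀ ∧ HasMode s' m' ∧ (∀ h, HasCount s h → HasCount s' h) ∧
      (zero = true → ∀ h < 2 ^ M, HasCount s h → h = 0) := by
  have hm : m = m₀ := (hs m ⟨0, hM⟩).1 (hf.1 (.mode m) ⟨0, hM⟩ (by simp [modeTemplate]))
  refine ⟨hm, fun x i => ?_, fun h hc b i => ?_, fun hz h hlt hc => ?_⟩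
  · rw [hf.iff, hs x i]
    simp only [modeTemplate, decide_eq_true_eq, decide_eq_false_iff_not, hm]
    tauto
  · rw [hf.iff, hc b i]
    simp [modeTemplate]
  · apply Nat.eq_of_testBit_eq
    intro i
    rw [Nat.zero_testBit]
    by_cases hi : i < M
    · exact (hc false ⟨i, hi⟩).1 (hf.1 (.bit false) ⟨i, hi⟩ (by simp [modeTemplate, hz]))
    · exact Nat.testBit_lt_two_pow (hlt.trans_le (Nat.pow_le_pow_right (by omega) (not_lt.1 hi)))

theorem modeTemplate_exists {zero : Bool} (j : Fin M) (hs : HasMode s m)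
    (hz : zero = true → HasCount s 0) : ∃ s', (modeTemplate m ℓ m' zero).Fires j s s' := by
  refine Template.exists_fires _ j s fun φ i h => ?_
  cases φ with
  | mode x => exact (hs x i).2 (by simpa [modeTemplate] using h)
  | bit b =>
    simp only [modeTemplate, Bool.and_eq_true, Bool.not_eq_true'] at h
    exact (hz h.1 b i).2 (by simp [h.2])
  | _ => simp [modeTemplate] at h

/-- There is no overflow and no underflow, because the bit at the position of the action is the one
at which the carry stops. -/
theorem countTemplate_fires {up : Bool} (hM : 0 < M) (hs : HasMode s m₀)
    (hf : (countTemplate m ℓ up).Fires j s s') :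
    m = m₀ ∧ HasMode s' m ∧ ∀ h < 2 ^ M, HasCount s h →
      ∃ h' < 2 ^ M, HasCount s' h' ∧ if up then h' = h + 1 else h = h' + 1 := by
  have hm : m = m₀ := (hs m ⟨0, hM⟩).1 (hf.1 (.mode m) ⟨0, hM⟩ (by simp [countTemplate]))
  refine ⟨hm, fun x i => ?_, fun h hlt hc => ?_⟩
  · rw [hf.iff, hs x i]
    simp [countTemplate, hm]
  have hlow : ∀ i < (j : ℕ), h.testBit i = up := fun i hi =>
    (hc up ⟨i, hi.trans j.isLt⟩).1 (hf.1 _ _ (by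
      simp [countTemplate, compare_lt_iff_lt, Fin.lt_def, hi]))
  have hj : h.testBit j = !up := (hc (!up) j).1 (hf.1 _ _ (by simp [countTemplate]))
  have hs' : ∀ b (i : Fin M), s' (Schema.fluent (.bit b) i) = true ↔
      (if (i : ℕ) < j then !up else if (i : ℕ) = j then up else h.testBit i) = b := by
    intro b i
    rw [hf.iff, hc b i]
    rcases lt_trichotomy (i : ℕ) j with hi | hi | hi
    · have hc : compare i j = .lt := compare_lt_iff_lt.2 hi
      simp only [countTemplate, hc, hi, if_true, hlow i hi]
      cases up <;> cases b <;> simp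
    · have hc : compare i j = .eq := compare_eq_iff_eq.2 (Fin.ext hi)
      simp only [countTemplate, hc, hi, lt_irrefl, if_false, if_true, hj]
      cases up <;> cases b <;> simp
    · have hc : compare i j = .gt := compare_gt_iff_gt.2 hi
      simp [countTemplate, hc, hi.not_gt, hi.ne']
  cases up with
  | true =>
    refine ⟨h + 1, succ_lt_two_pow hlt j.isLt (by simpa using hj), fun b i => ?_, rfl⟩
    rw [hs', testBit_add_one j h hlow (by simpa using hj)]
    simp
  | false =>
    obtain ⟨hpos, hsub⟩ := testBit_sub_one j h hlow (by simpa using hj)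
    refine ⟨h - 1, by omega, fun b i => ?_, by simp; omega⟩
    rw [hs', hsub]
    simp

theorem countUp_exists {h : ℕ} (hM : 0 < M) (hs : HasMode s m) (hc : HasCount s h)
    (hh : h + 1 < 2 ^ M) : ∃ (j : Fin M) (s' : PlanState K S Q M),
      (countTemplate m ℓ true).Fires j s s' ∧ HasMode s' m ∧ HasCount s' (h + 1) := by
  obtain ⟨j, hj, hlow, hz⟩ := exists_lowest_zero hh
  obtain ⟨s', hf⟩ := (countTemplate (Q := Q) m ℓ true).exists_fires ⟨j, hj⟩ s fun φ i hp => by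
    cases φ with
    | mode x => exact (hs x i).2 (by simpa [countTemplate] using hp)
    | bit b =>
      simp only [countTemplate, decide_eq_true_eq, compare_lt_iff_lt, compare_eq_iff_eq] at hp
      rcases hp with ⟨hi, rfl⟩ | ⟨rfl, rfl⟩
      · exact (hc true i).2 (hlow i hi)
      · exact (hc _ _).2 (by simpa using hz)
    | _ => simp [countTemplate] at hp
  obtain ⟨-, h1, h2⟩ := countTemplate_fires hM hs hf
  obtain ⟨h', -, h3, h4⟩ := h2 h (by omega) hc
  have : h' = h + 1 := by simpa using h4
  exact ⟨_, s', hf, h1, this ▸ h3⟩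

theorem countDown_exists {h : ℕ} (hM : 0 < M) (hs : HasMode s m) (hc : HasCount s (h + 1))
    (hh : h + 1 < 2 ^ M) : ∃ (j : Fin M) (s' : PlanState K S Q M),
      (countTemplate m ℓ false).Fires j s s' ∧ HasMode s' m ∧ HasCount s' h := by
  obtain ⟨j, hj, hlow, hz⟩ := exists_lowest_one (Nat.succ_pos h) hh
  obtain ⟨s', hf⟩ := (countTemplate (Q := Q) m ℓ false).exists_fires ⟨j, hj⟩ s fun φ i hp => by
    cases φ with
    | mode x => exact (hs x i).2 (by simpa [countTemplate] using hp)
    | bit b =>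
      simp only [countTemplate, decide_eq_true_eq, compare_lt_iff_lt, compare_eq_iff_eq] at hp
      rcases hp with ⟨hi, rfl⟩ | ⟨rfl, rfl⟩
      · exact (hc false i).2 (hlow i hi)
      · exact (hc _ _).2 (by simpa using hz)
    | _ => simp [countTemplate] at hp
  obtain ⟨-, h1, h2⟩ := countTemplate_fires hM hs hf
  obtain ⟨h', -, h3, h4⟩ := h2 (h + 1) hh hc
  have : h = h' := by simpa using h4
  exact ⟨_, s', hf, h1, this ▸ h3⟩

theorem ctlTemplate_fires {c c' : Control Q} {wait : Bool} (hM : 0 < M) (hs : HasMode s m₀)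
    (hf : (ctlTemplate c ℓ c' wait).Fires j s s') :
    m₀ = .main ∧ HasMode s' .main ∧ (∀ h, HasCount s h → HasCount s' h) ∧
      (∀ c₀, HasCtl s c₀ → c = c₀ ∧ HasCtl s' c') ∧
      (∀ w n, HasFed w s n → HasFed w s' n ∧ (wait = true → n = 0)) := by
  have hm : .main = m₀ := (hs .main ⟨0, hM⟩).1 (hf.1 (.mode .main) ⟨0, hM⟩ (by simp [ctlTemplate]))
  subst hm
  refine ⟨rfl, fun x i => ?_, fun h hc b i => ?_, fun c₀ hc => ?_, fun w n hn => ?_⟩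
  · rw [hf.iff, hs x i]
    simp [ctlTemplate]
  · rw [hf.iff, hc b i]
    simp [ctlTemplate]
  · have hcc : c = c₀ := (hc c ⟨0, hM⟩).1 (hf.1 (.ctl c) ⟨0, hM⟩ (by simp [ctlTemplate]))
    refine ⟨hcc, fun x i => ?_⟩
    rw [hf.iff, hc x i]
    simp only [ctlTemplate, decide_eq_true_eq, decide_eq_false_iff_not, hcc]
    tauto
  · refine ⟨⟨fun i => ?_, fun b i => ?_⟩, fun hwait => ?_⟩
    · rw [hf.iff, hn.1 i]
      simp [ctlTemplate]
    · rw [hf.iff, hn.2 b i]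
      simp [ctlTemplate]
    · have := (hn.1 ⟨0, hM⟩).1 (hf.1 .fed ⟨0, hM⟩ (by simp [ctlTemplate, hwait]))
      simpa using this

theorem ctlTemplate_exists {c c' : Control Q} {wait : Bool} {w : List Bool} (j : Fin M)
    (hs : HasMode s .main) (hc : HasCtl s c) (hw : wait = true → HasFed w s 0) :
    ∃ s', (ctlTemplate c ℓ c' wait).Fires j s s' := by
  refine Template.exists_fires _ j s fun φ i h => ?_
  cases φ with
  | mode x => exact (hs x i).2 (by simpa [ctlTemplate] using h)
  | ctl x => exact (hc x i).2 (by simpa [ctlTemplate] using h)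
  | fed => exact ((hw (by simpa [ctlTemplate] using h)).1 i).2 (Nat.zero_le _)
  | _ => simp [ctlTemplate] at h

/-- The input is processed from its end, so that its first symbol comes to lie on top. -/
theorem inputTemplate_fires {A : StackMachine K S Q} {b : Option Bool} (hM : 0 < M)
    (hs : HasMode s m₀) (hf : (A.inputTemplate b).Fires j s s') :
    m₀ = .main ∧ HasMode s' .main ∧ (∀ h, HasCount s h → HasCount s' h) ∧
      (∀ c₀, HasCtl s c₀ → .feed = c₀ ∧ HasCtl s' .feed) ∧
      (∀ w n, HasFed w s n → n ≤ M → n = j + 1 ∧ w[(j : ℕ)]? = b ∧ HasFed w s' j) := by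
  have hm : .main = m₀ := (hs .main ⟨0, hM⟩).1 (hf.1 (.mode .main) ⟨0, hM⟩
    (by simp [inputTemplate]))
  subst hm
  refine ⟨rfl, fun x i => ?_, fun h hc b i => ?_, fun c₀ hc => ?_, fun w n hn hnM => ?_⟩
  · rw [hf.iff, hs x i]
    simp [inputTemplate]
  · rw [hf.iff, hc b i]
    simp [inputTemplate]
  · have hcc : .feed = c₀ := (hc .feed ⟨0, hM⟩).1 (hf.1 (.ctl .feed) ⟨0, hM⟩
      (by simp [inputTemplate]))
    refine ⟨hcc, fun x i => ?_⟩
    rw [hf.iff, hc x i]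
    simp [inputTemplate, hcc]
  · have hj := (hn.2 b j).1 (hf.1 (.input b) j (by simp [inputTemplate]))
    have hnj : n = j + 1 := by
      refine le_antisymm ?_ hj.1
      by_cases hlt : (j : ℕ) + 1 < M
      · exact (hn.1 ⟨j + 1, hlt⟩).1 (hf.1 .fed ⟨j + 1, hlt⟩ (by
          have : compare (⟨j + 1, hlt⟩ : Fin M) j = .gt :=
            compare_gt_iff_gt.2 (Fin.lt_def.2 (Nat.lt_succ_self _))
          simp [inputTemplate, this]))
      · omega
    refine ⟨hnj, hj.2, fun i => ?_, fun b' i => ?_⟩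
    · rw [hf.iff, hn.1 i]
      simp only [inputTemplate, decide_eq_true_eq, compare_eq_iff_eq, Fin.ext_iff]
      simp
      omega
    · rw [hf.iff, hn.2 b' i]
      simp only [inputTemplate, decide_eq_false_iff_not, compare_eq_iff_eq,
        Fin.ext_iff, Bool.false_eq_true, or_false]
      constructor
      · rintro ⟨⟨h1, h2⟩, h3⟩
        refine ⟨?_, h2⟩
        rcases Nat.lt_succ_iff_lt_or_eq.1 (hnj ▸ h1) with h4 | h4
        · exact h4
        · exact absurd ⟨by rw [← h2, h4, hj.2], h4⟩ h3
      · rintro ⟨h1, h2⟩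
        exact ⟨⟨by omega, h2⟩, fun h3 => by omega⟩

theorem inputTemplate_exists {A : StackMachine K S Q} {b : Option Bool} {w : List Bool}
    (hs : HasMode s .main) (hc : HasCtl s .feed) (hw : HasFed w s (j + 1))
    (hb : w[(j : ℕ)]? = b) : ∃ s', (A.inputTemplate b).Fires j s s' := by
  refine Template.exists_fires _ j s fun φ i h => ?_
  cases φ with
  | mode x => exact (hs x i).2 (by simpa [inputTemplate] using h)
  | ctl x => exact (hc x i).2 (by simpa [inputTemplate] using h)
  | fed =>
    simp only [inputTemplate, decide_eq_true_eq, compare_gt_iff_gt] at h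
    exact (hw.1 i).2 h
  | input b' =>
    simp only [inputTemplate, decide_eq_true_eq, compare_eq_iff_eq] at h
    obtain ⟨rfl, rfl⟩ := h
    exact (hw.2 _ _).2 ⟨Nat.lt_succ_self _, hb⟩
  | _ => simp [inputTemplate] at h

end templates

end StackMachine

/-! ### Histories of runs are exactly the histories without errors -/

namespace StackMachine

variable {K S Q : Type} [DecidableEq K] [Fintype K] [Fintype S] [Fintype Q] {M : ℕ}

/-- What is possible for a state of the belief after a truthful history that leads to the
stacks `st`: it runs the machine, or it checks a symbol that is really on a stack, and the counter
holds the number of symbols above it. -/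
def Sound (st : K → List S) (s : PlanState K S Q M) : Prop :=
  (HasMode s .main ∧ HasCount s 0) ∨
    ∃ k g h, HasMode s (.check k g) ∧ h < 2 ^ M ∧ HasCount s h ∧ Tracked st k h g

/-- Soundness is kept by truthful letters. In particular no check comes to the mode `error`. -/
theorem Sound.fires (hM : 0 < M) {A : StackMachine K S Q} {st : K → List S}
    {s s' : PlanState K S Q M} {t : Template (Family K S Q) (Letter K S)} {j : Fin M}
    (hs : Sound st s) (ht : A.IsTemplate t) (hf : t.Fires j s s')
    (htrue : t.letter.Truthful st) : Sound (t.letter.effect st) s' := by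
  have hmain : ∀ {m : Mode K S}, HasMode s m → m = .main → HasCount s 0 := by
    rintro m hm rfl
    rcases hs with ⟨-, h⟩ | ⟨k, g, h, h1, -⟩
    · exact h
    · cases h1.unique hM hm
  have hcheck : ∀ {m : Mode K S} {k : K} {g : Option S}, HasMode s m → m = .check k g →
      ∃ h < 2 ^ M, HasCount s h ∧ Tracked st k h g := by
    rintro m k g hm rfl
    rcases hs with ⟨h, -⟩ | ⟨k', g', h, h1, h2⟩
    · cases h.unique hM hm
    · cases h1.unique hM hm
      exact ⟨h, h2⟩
  obtain ⟨m, hm⟩ : ∃ m, HasMode s m := by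
    rcases hs with ⟨h, -⟩ | ⟨k, g, h, h1, -⟩
    · exact ⟨_, h⟩
    · exact ⟨_, h1⟩
  cases ht with
  | begin | launch | exec _ =>
    obtain ⟨h1, h2, h3, -⟩ := ctlTemplate_fires hM hm hf
    exact .inl ⟨h2, h3 _ (hmain hm h1)⟩
  | input b =>
    obtain ⟨h1, h2, h3, -⟩ := inputTemplate_fires hM hm hf
    exact .inl ⟨h2, h3 _ (hmain hm h1)⟩
  | @spawn ℓ k g hsp =>
    obtain ⟨h1, h2, h3, -⟩ := modeTemplate_fires hM hm hf
    refine .inr ⟨k, g, 0, h2, by positivity, h3 _ (hmain hm h1.symm), ?_⟩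
    rw [tracked_zero]
    cases hsp with
    | start =>
      have : st k = [] := htrue k
      simp [modeTemplate, Letter.effect, this]
    | push => simp [modeTemplate, Letter.effect]
  | @keep ℓ k g hk =>
    obtain ⟨h1, h2, h3, -⟩ := modeTemplate_fires hM hm hf
    obtain ⟨h, hlt, hc, htr⟩ := hcheck hm h1.symm
    exact .inr ⟨k, g, h, h2, hlt, h3 _ hc, (tracked_congr (hk.effect_apply htrue)).2 htr⟩
  | up k g x =>
    obtain ⟨h1, h2, h3⟩ := countTemplate_fires hM hm hf
    obtain ⟨h, hlt, hc, htr⟩ := hcheck hm h1.symm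
    obtain ⟨h', hlt', hc', e⟩ := h3 h hlt hc
    have e : h' = h + 1 := by simpa using e
    subst e
    exact .inr ⟨k, g, h + 1, h2, hlt', hc',
      (tracked_push (x := x) (by simp [countTemplate, Letter.effect])).2 htr⟩
  | down k g x =>
    obtain ⟨h1, h2, h3⟩ := countTemplate_fires hM hm hf
    obtain ⟨h, hlt, hc, htr⟩ := hcheck hm h1.symm
    obtain ⟨h', hlt', hc', e⟩ := h3 h hlt hc
    have e : h = h' + 1 := by simpa using e
    subst e
    have hx : (st k).head? = some x := htrue
    have hst : st k = x :: (st k).tail := (List.cons_head?_tail hx).symm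
    exact .inr ⟨k, g, h', h2, hlt', hc',
      (tracked_push (by simpa [countTemplate, Letter.effect] using hst)).1 htr⟩
  | @clash k g x drop hne =>
    obtain ⟨h1, -, -, h4⟩ := modeTemplate_fires hM hm hf
    obtain ⟨h, hlt, hc, htr⟩ := hcheck hm h1.symm
    obtain rfl := h4 rfl h hlt hc
    exact absurd ((show (st k).head? = x from htrue).symm.trans (tracked_zero.1 htr)) hne
  | error ℓ =>
    obtain ⟨rfl, -⟩ := modeTemplate_fires hM hm hf
    rcases hs with ⟨h, -⟩ | ⟨k', g', h, h1, h2⟩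
    · cases h.unique hM hm
    · cases h1.unique hM hm

/-- Every symbol that is on a stack, and the bottom of every stack, is checked by some state of the
belief. -/
def Complete (st : K → List S) (b : Set (PlanState K S Q M)) : Prop :=
  ∀ k h g, Tracked st k h g → ∃ s ∈ b, HasMode s (.check k g) ∧ HasCount s h

variable (A : StackMachine K S Q) (w : List Bool)

/-- The state stands for a configuration of the agent: `st` are the stacks so far, and if the
machine is running, the configuration is reached by it. -/
def Represents (s : PlanState K S Q M) (c : Control Q) (st : K → List S) : Prop :=
  HasMode s .main ∧ HasCtl s c ∧ HasCount s 0 ∧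
    match c with
    | .start => st = (fun _ => []) ∧ HasFed w s M
    | .feed => ∃ n ≤ M, st = A.inputStacks (w.drop n) ∧ HasFed w s n
    | .run q => A.Reaches w (q, st)

variable {A w}

theorem represents_init :
    A.Represents w ((A.schema.problem M w).init : PlanState K S Q M) .start fun _ => [] := by
  have h : ∀ (φ : Family K S Q) (i : Fin M),
      (A.schema.problem M w).init (Schema.fluent φ i) = A.schema.initValue w φ i := fun φ i => by
    simp [Schema.problem]
  refine ⟨fun m i => ?_, fun c i => ?_, fun b i => ?_, rfl, fun i => ?_, fun b i => ?_⟩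
  · rw [h]; simp [Schema.initValue, schema]
  · rw [h]; simp [Schema.initValue, schema]
  · rw [h]; cases b <;> simp [Schema.initValue, schema]
  · rw [h]; simp [Schema.initValue, schema]
  · rw [h]; simp [Schema.initValue, schema]

omit [DecidableEq K] in
/-- Only the mode and the counter are visible at the start, so all control states are possible. -/
theorem mem_initBelief_iff {s : PlanState K S Q M} :
    s ∈ (A.schema.problem M w).initBelief (A.schema.problem M w).init ↔
      HasMode s .main ∧ HasCount s 0 := by
  refine (A.schema.mem_initBelief (by simp [schema]) (fun φ b hb => ?_)).trans ?_
  · cases φ <;> simp_all [schema]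
  · constructor
    · refine fun h => ⟨fun m i => ?_, fun b i => ?_⟩
      · rw [h (.mode m) i _ rfl]; simp
      · rw [h (.bit b) i _ rfl]; cases b <;> simp
    · rintro ⟨h1, h2⟩ φ i b hb
      cases φ with
      | mode m =>
        have := h1 m i
        simp only [schema, Option.some.injEq] at hb
        subst hb
        by_cases hm : m = .main <;> simp_all
      | bit b' =>
        have := h2 b' i
        simp only [schema, Option.some.injEq] at hb
        subst hb
        cases b' <;> simp_all
      | _ => simp [schema] at hb

omit [DecidableEq K] in
theorem sat_other_iff (hM : 0 < M) {s : PlanState K S Q M} {m : Mode K S} (hs : HasMode s m) :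
    s.Sat (fun x => A.schema.other (Schema.family x)) ↔ m = .error := by
  constructor
  · intro h
    have := h (Schema.fluent (.mode .error) ⟨0, hM⟩) true (by simp [schema])
    exact ((hs _ _).1 this).symm
  · rintro rfl x b hb
    obtain ⟨φ, i, rfl⟩ : ∃ φ i, x = Schema.fluent φ i := ⟨_, _, (Schema.fluent_family x).symm⟩
    simp only [Schema.family_fluent] at hb
    cases φ with
    | mode m =>
      simp only [schema] at hb
      split_ifs at hb with h
      · rw [← Option.some.inj hb]
        exact (hs m i).2 h
    | _ => simp [schema] at hb

omit [DecidableEq K] in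
theorem sat_goal_iff (hM : 0 < M) {s : PlanState K S Q M} {m : Mode K S} (hs : HasMode s m) :
    s.Sat (fun x => A.schema.goal (Schema.family x)) ↔
      m = .main ∧ ∀ i, s (Schema.fluent (.ctl (.run A.accept)) i) = true := by
  constructor
  · intro h
    refine ⟨?_, fun i => h _ true (by simp [schema])⟩
    have := h (Schema.fluent (.mode .main) ⟨0, hM⟩) true (by simp [schema])
    exact ((hs _ _).1 this).symm
  · rintro ⟨rfl, hc⟩ x b hb
    obtain ⟨φ, i, rfl⟩ : ∃ φ i, x = Schema.fluent φ i := ⟨_, _, (Schema.fluent_family x).symm⟩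
    simp only [Schema.family_fluent] at hb
    cases φ with
    | mode m =>
      simp only [schema] at hb
      split_ifs at hb with h
      · rw [← Option.some.inj hb]
        exact (hs m i).2 h
    | ctl c =>
      simp only [schema] at hb
      split_ifs at hb with h
      · rw [← Option.some.inj hb, h]
        exact hc i
    | _ => simp [schema] at hb

omit [Fintype K] [Fintype S] [Fintype Q] in
/-- Processing the position `n` of the input pushes the bit that is there, if there is one. -/
theorem inputStacks_drop (n : ℕ) :
    A.inputStacks (w.drop n) =
      (A.inputTemplate w[n]?).letter.effect (A.inputStacks (w.drop (n + 1))) := by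
  by_cases hn : n < w.length
  · rw [List.drop_eq_getElem_cons hn, List.getElem?_eq_getElem hn]
    simp only [inputTemplate, Option.elim, Letter.effect, inputStacks, List.map_cons,
      Function.update_self, Function.update_idem]
  · rw [List.getElem?_eq_none (not_lt.1 hn), List.drop_eq_nil_of_le (not_lt.1 hn),
      List.drop_eq_nil_of_le (by omega)]
    rfl

omit [DecidableEq K] [Fintype K] [Fintype S] [Fintype Q] in
theorem inputTemplate_truthful (b : Option Bool) (st : K → List S) :
    (A.inputTemplate b).letter.Truthful st := by
  cases b <;> trivial

/-! #### A run gives a plan -/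

variable (A w) in
/-- There is a plan that leads to `s`, such that its last belief is sound for `st`. -/
def Attains (s : PlanState K S Q M) (st : K → List S) : Prop :=
  ∃ π, (A.schema.problem M w).run (A.schema.problem M w).init π = some s ∧
    ∀ x ∈ (A.schema.problem M w).lastBelief π, Sound (M := M) (Q := Q) st x

theorem Attains.fires (hM : 0 < M) {st : K → List S} {s s' : PlanState K S Q M}
    {t : Template (Family K S Q) (Letter K S)} {j : Fin M} (h : A.Attains w s st)
    (ht : A.IsTemplate t) (hf : t.Fires j s s') (htrue : t.letter.Truthful st) :
    A.Attains w s' (t.letter.effect st) := by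
  obtain ⟨π, hπ, hb⟩ := h
  obtain ⟨a, rfl, rfl⟩ := A.schema.exists_action (A.mem_templates.2 ht) j
  obtain ⟨h1, h2⟩ := COProblem.run_concat _ hπ ((A.schema.step_eq_some (w := w)).2 hf)
  refine ⟨_, h1, fun x hx => ?_⟩
  rw [COProblem.lastBelief, h2, List.foldl_append] at hx
  obtain ⟨y, hy, t', ht', hℓ, j', hf'⟩ := A.schema.mem_update.1 hx
  rw [← hℓ] at htrue ⊢
  exact (hb y hy).fires hM (A.mem_templates.1 ht') hf' htrue

/-- A run is carried out step by step, after the input has been pushed. Its claims are true, so that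
the belief stays sound. -/
theorem attains_of_reaches (hM : 0 < M) (hw : w.length ≤ M) {c : Q × (K → List S)}
    (hc : A.Reaches w c) :
    ∃ s : PlanState K S Q M, A.Attains w s c.2 ∧ A.Represents w s (.run c.1) c.2 := by
  have hj : Fin M := ⟨0, hM⟩
  have hstart : ∃ s : PlanState K S Q M, A.Attains w s (fun _ => []) ∧
      A.Represents w s .start fun _ => [] := by
    refine ⟨_, ⟨[], rfl, fun x hx => ?_⟩, represents_init⟩
    exact .inl (mem_initBelief_iff.1 hx)
  have hfeed : ∀ n ≤ M, ∃ s : PlanState K S Q M, A.Attains w s (A.inputStacks (w.drop (M - n))) ∧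
      HasMode s .main ∧ HasCtl s .feed ∧ HasCount s 0 ∧ HasFed w s (M - n) := by
    intro n
    induction n with
    | zero =>
      intro _
      obtain ⟨s, hs, h1, h2, h3, -, h4⟩ := hstart
      obtain ⟨s', hf⟩ := ctlTemplate_exists (ℓ := Letter.start) (c' := .feed) (wait := false)
        (w := w) hj h1 h2 (by simp)
      obtain ⟨-, k2, k3, k4, k5⟩ := ctlTemplate_fires hM h1 hf
      refine ⟨s', ?_, k2, (k4 _ h2).2, k3 _ h3, (k5 _ _ h4).1⟩
      have := hs.fires hM .begin hf (fun _ => rfl)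
      rw [Nat.sub_zero, List.drop_eq_nil_of_le hw]
      convert this using 1
      simp [inputStacks, ctlTemplate, Letter.effect]
    | succ n ih =>
      intro hn
      obtain ⟨s, hs, h1, h2, h3, h4⟩ := ih (by omega)
      have e : M - n = M - (n + 1) + 1 := by omega
      rw [e] at hs h4
      obtain ⟨s', hf⟩ := inputTemplate_exists (A := A) (j := ⟨M - (n + 1), by omega⟩) h1 h2 h4 rfl
      obtain ⟨-, k2, k3, k4, k5⟩ := inputTemplate_fires hM h1 hf
      refine ⟨s', ?_, k2, (k4 _ h2).2, k3 _ h3, (k5 _ _ h4 (by omega)).2.2⟩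
      rw [inputStacks_drop]
      exact hs.fires hM (.input _) hf (inputTemplate_truthful _ _)
  induction hc with
  | refl =>
    obtain ⟨s, hs, h1, h2, h3, h4⟩ := hfeed M le_rfl
    rw [Nat.sub_self] at hs h4
    obtain ⟨s', hf⟩ := ctlTemplate_exists (ℓ := Letter.nop) (c' := .run A.start) (wait := true)
      (w := w) hj h1 h2 (fun _ => h4)
    obtain ⟨-, k2, k3, k4, k5⟩ := ctlTemplate_fires hM h1 hf
    exact ⟨s', hs.fires hM .launch hf trivial, k2, (k4 _ h2).2, k3 _ h3, .refl⟩
  | tail hr hstep ih =>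
    obtain ⟨s, hs, h1, h2, h3, h4⟩ := ih
    cases hstep with
    | @mk q q' x ℓ st hout htrue =>
      obtain ⟨s', hf⟩ := ctlTemplate_exists (ℓ := ℓ) (c' := .run q') (wait := false)
        (w := w) hj h1 h2 (by simp)
      obtain ⟨-, k2, k3, k4, k5⟩ := ctlTemplate_fires hM h1 hf
      exact ⟨s', hs.fires hM (.exec hout) hf htrue, k2, (k4 _ h2).2, k3 _ h3,
        hr.tail (.mk hout htrue)⟩

/-! #### A legible plan gives a run -/

omit [DecidableEq K] in
/-- An error is never forgotten: it is compatible with all letters. -/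
theorem exists_error_foldl (hM : 0 < M) {b : Set (PlanState K S Q M)}
    (hb : ∃ s ∈ b, HasMode s .error) (l : List (Fin (A.schema.problem M w).nObs)) :
    ∃ s ∈ l.foldl (A.schema.problem M w).update b, HasMode (M := M) (Q := Q) s .error := by
  induction l generalizing b with
  | nil => exact hb
  | cons o l ih =>
    obtain ⟨s, hs, hm⟩ := hb
    obtain ⟨ℓ, rfl⟩ := A.schema.letterObs_surjective M w o
    obtain ⟨s', hf⟩ := modeTemplate_exists (ℓ := ℓ) (m' := .error) (zero := false) ⟨0, hM⟩ hm
      (by simp)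
    exact ih ⟨s', A.schema.mem_update.2 ⟨s, hs, _, A.mem_templates.2 (.error ℓ), rfl, _, hf⟩,
      (modeTemplate_fires hM hm hf).2.1⟩

omit [DecidableEq K] in
/-- A wrong claim is detected by the check of the symbol that is really on top. -/
theorem Complete.exists_error (hM : 0 < M) {st : K → List S} {b : Set (PlanState K S Q M)}
    (hb : Complete st b) {k : K} {drop : Bool} {x : Option S} (hx : (st k).head? ≠ x) :
    ∃ s ∈ (A.schema.problem M w).update b (A.schema.letterObs M w (.read k drop x)),
      HasMode (M := M) (Q := Q) s .error := by
  obtain ⟨s, hs, hm, hc⟩ := hb k 0 _ (tracked_zero.2 rfl)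
  obtain ⟨s', hf⟩ := modeTemplate_exists (ℓ := Letter.read k drop x) (m' := .error) (zero := true)
    ⟨0, hM⟩ hm (fun _ => hc)
  exact ⟨s', A.schema.mem_update.2 ⟨s, hs, _, A.mem_templates.2 (.clash drop (Ne.symm hx)), rfl, _,
    hf⟩, (modeTemplate_fires hM hm hf).2.1⟩

omit [DecidableEq K] in
/-- After the first letter, which says that all stacks are empty, the bottoms of the stacks are
checked. -/
theorem complete_start (hM : 0 < M) {b : Set (PlanState K S Q M)} {s : PlanState K S Q M}
    (hs : s ∈ b) (hm : HasMode s .main) (hc : HasCount s 0) :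
    Complete (M := M) (Q := Q) (fun _ => [])
      ((A.schema.problem M w).update b (A.schema.letterObs M w .start)) := by
  intro k h g ht
  have h0 : h = 0 := Nat.le_zero.1 ht.le_length
  subst h0
  obtain rfl : none = g := tracked_zero.1 ht
  obtain ⟨s', hf⟩ := modeTemplate_exists (ℓ := Letter.start) (m' := .check k none) (zero := false)
    ⟨0, hM⟩ hm (by simp)
  obtain ⟨-, h1, h2, -⟩ := modeTemplate_fires hM hm hf
  exact ⟨s', A.schema.mem_update.2 ⟨s, hs, _, A.mem_templates.2 (.spawn (.start k)), rfl, _, hf⟩,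
    h1, h2 _ hc⟩

/-- Truthful letters keep completeness: the checks of the old symbols go on, and the check of a new
symbol arises from a state of the mode `main`. The bounds on the stacks prevent an overflow of the
counters. -/
theorem Complete.update (hM : 0 < M) {st : K → List S} {b : Set (PlanState K S Q M)}
    (hb : Complete st b) {s : PlanState K S Q M} (hs : s ∈ b) (hm : HasMode s .main)
    (hc : HasCount s 0) {ℓ : Letter K S} (htrue : ℓ.Truthful st)
    (hlen : ∀ k, (st k).length < 2 ^ M) (hlen' : ∀ k, (ℓ.effect st k).length < 2 ^ M) :
    Complete (M := M) (Q := Q) (ℓ.effect st)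
      ((A.schema.problem M w).update b (A.schema.letterObs M w ℓ)) := by
  intro k h g ht
  have key : ∀ {t : Template (Family K S Q) (Letter K S)} {x x' : PlanState K S Q M} {j : Fin M},
      A.IsTemplate t → x ∈ b → t.letter = ℓ → t.Fires j x x' →
        x' ∈ (A.schema.problem M w).update b (A.schema.letterObs M w ℓ) :=
    fun ht hx hl hf => A.schema.mem_update.2 ⟨_, hx, _, A.mem_templates.2 ht, hl, _, hf⟩
  by_cases hk : ℓ.Keeps k
  · obtain ⟨x, hx, h1, h2⟩ := hb k h g ((tracked_congr (hk.effect_apply htrue)).1 ht)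
    obtain ⟨x', hf⟩ := modeTemplate_exists (ℓ := ℓ) (m' := .check k g) (zero := false)
      ⟨0, hM⟩ h1 (by simp)
    obtain ⟨-, k1, k2, -⟩ := modeTemplate_fires hM h1 hf
    exact ⟨x', key (.keep g hk) hx rfl hf, k1, k2 _ h2⟩
  · rcases Letter.eq_of_not_keeps hk with ⟨y, rfl⟩ | ⟨y, rfl⟩
    · have he : Letter.effect (.push k y) st k = y :: st k := by simp [Letter.effect]
      cases h with
      | zero =>
        obtain rfl : some y = g := by simpa [he] using tracked_zero.1 ht
        obtain ⟨x', hf⟩ := modeTemplate_exists (ℓ := Letter.push k y) (m' := .check k (some y))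
          (zero := false) ⟨0, hM⟩ hm (by simp)
        obtain ⟨-, k1, k2, -⟩ := modeTemplate_fires hM hm hf
        exact ⟨x', key (.spawn (.push k y)) hs rfl hf, k1, k2 _ hc⟩
      | succ h =>
        obtain ⟨x, hx, h1, h2⟩ := hb k h g ((tracked_push he).1 ht)
        obtain ⟨j, x', hf, k1, k2⟩ := countUp_exists (ℓ := Letter.push k y) hM h1 h2
          (ht.le_length.trans_lt (hlen' k))
        exact ⟨x', key (.up k g y) hx rfl hf, k1, k2⟩
    · have hy : (st k).head? = some y := htrue
      have he : st k = y :: Letter.effect (.read k true (some y)) st k := by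
        simpa [Letter.effect] using (List.cons_head?_tail hy).symm
      have ht' : Tracked st k (h + 1) g := (tracked_push he).2 ht
      obtain ⟨x, hx, h1, h2⟩ := hb k (h + 1) g ht'
      obtain ⟨j, x', hf, k1, k2⟩ := countDown_exists (ℓ := Letter.read k true (some y)) hM h1 h2
        (ht'.le_length.trans_lt (hlen k))
      exact ⟨x', key (.down k g y) hx rfl hf, k1, k2⟩

omit [DecidableEq K] in
/-- There is no way back to the mode `main`. -/
theorem mode_ne_main_of_run (hM : 0 < M) {s s' : PlanState K S Q M} {m : Mode K S}
    (hs : HasMode s m) (hm : m ≠ .main) {π : List (Fin (A.schema.problem M w).nActions)}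
    (h : (A.schema.problem M w).run s π = some s') : ∃ m', m' ≠ .main ∧ HasMode s' m' := by
  induction π generalizing s m with
  | nil =>
    obtain rfl : s = s' := Option.some.inj h
    exact ⟨m, hm, hs⟩
  | cons a π ih =>
    obtain ⟨s₁, h1, h2⟩ := (COProblem.run_cons _).1 h
    have hf := A.schema.step_eq_some.1 h1
    have ht := A.mem_templates.1 (A.schema.template_mem a)
    generalize A.schema.template a = t at hf ht
    cases ht with
    | begin | launch | exec _ => exact absurd (ctlTemplate_fires hM hs hf).1 hm
    | input b => exact absurd (inputTemplate_fires hM hs hf).1 hm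
    | spawn _ => exact absurd (modeTemplate_fires hM hs hf).1.symm hm
    | keep _ _ | clash _ _ | error _ => exact ih (modeTemplate_fires hM hs hf).2.1 (by simp) h2
    | up _ _ _ | down _ _ _ => exact ih (countTemplate_fires hM hs hf).2.1 (by simp) h2

/-- The actions of a plan that reaches the true goal are steps of the machine, since the mode `main`
is never left, and their claims are true if the last belief is free of errors. -/
theorem reaches_of_run (hM : 0 < M) (hw : w.length ≤ M)
    (hlen : ∀ q st, A.Reaches w (q, st) → ∀ k, (st k).length < 2 ^ M)
    (π : List (Fin (A.schema.problem M w).nActions)) {s s' : PlanState K S Q M}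
    {b : Set (PlanState K S Q M)} {c : Control Q} {st : K → List S}
    (hr : A.Represents w s c st) (hs : s ∈ b) (hb : c ≠ .start → Complete st b)
    (h : (A.schema.problem M w).run s π = some s')
    (hgoal : s'.Sat (fun x => A.schema.goal (Schema.family x)))
    (herr : ∀ x ∈ ((A.schema.problem M w).emitted s π).foldl (A.schema.problem M w).update b,
      ¬ HasMode (M := M) (Q := Q) x .error) : ∃ st, A.Reaches w (A.accept, st) := by
  have hinp : ∀ n k, (A.inputStacks (w.drop n) k).length < 2 ^ M := by
    intro n k
    have h2 := M.lt_two_pow_self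
    unfold inputStacks
    by_cases hk : k = A.inStack
    · subst hk
      simp
      omega
    · rw [Function.update_of_ne hk]
      positivity
  induction π generalizing s b c st with
  | nil =>
    obtain rfl : s = s' := Option.some.inj h
    have hg := ((sat_goal_iff hM hr.1).1 hgoal).2 ⟨0, hM⟩
    obtain rfl := (hr.2.1 _ _).1 hg
    exact ⟨st, hr.2.2.2⟩
  | cons a π ih =>
    obtain ⟨s₁, h1, h2⟩ := (COProblem.run_cons _).1 h
    obtain ⟨hm, hctl, hc, hr⟩ := hr
    simp only [COProblem.emitted, h1] at herr
    change ∀ x ∈ ((A.schema.problem M w).emitted s₁ π).foldl (A.schema.problem M w).update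
      ((A.schema.problem M w).update b (A.schema.letterObs M w (A.schema.template a).letter)),
        ¬ HasMode (M := M) (Q := Q) x .error at herr
    have hf := A.schema.step_eq_some.1 h1
    have ht := A.mem_templates.1 (A.schema.template_mem a)
    have hs₁ : s₁ ∈ (A.schema.problem M w).update b
        (A.schema.letterObs M w (A.schema.template a).letter) := ⟨s, hs, a, h1, rfl⟩
    generalize A.schema.template a = t at hf ht herr hs₁
    generalize Schema.position a = j at hf
    have hback : ∀ m, HasMode s₁ m → m = .main := by
      intro m hm'
      by_contra hne
      obtain ⟨m', hne', hm''⟩ := mode_ne_main_of_run hM hm' hne h2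
      exact hne' ((sat_goal_iff hM hm'').1 hgoal).1
    cases ht with
    | begin =>
      obtain ⟨-, k1, k2, k3, k4⟩ := ctlTemplate_fires hM hm hf
      obtain ⟨rfl, k3⟩ := k3 _ hctl
      obtain ⟨rfl, hfed⟩ := hr
      refine ih (st := fun _ => []) ⟨k1, k3, k2 _ hc, M, le_rfl, ?_, (k4 _ _ hfed).1⟩ hs₁
        (fun _ => complete_start hM hs hm hc) h2 herr
      simp [List.drop_eq_nil_of_le hw, inputStacks]
    | input bit =>
      obtain ⟨-, k1, k2, k3, k4⟩ := inputTemplate_fires hM hm hf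
      obtain ⟨rfl, k3⟩ := k3 _ hctl
      obtain ⟨n, hn, rfl, hfed⟩ := hr
      obtain ⟨rfl, rfl, k5⟩ := k4 _ _ hfed hn
      have hst := (inputStacks_drop (A := A) (w := w) (j : ℕ)).symm
      have hcomp := (hb (by simp)).update (A := A) (w := w) hM hs hm hc
        (inputTemplate_truthful (A := A) _ _) (hinp _) (fun k => by rw [hst]; exact hinp _ k)
      rw [hst] at hcomp
      exact ih ⟨k1, k3, k2 _ hc, _, by omega, rfl, k5⟩ hs₁ (fun _ => hcomp) h2 herr
    | launch =>
      obtain ⟨-, k1, k2, k3, k4⟩ := ctlTemplate_fires hM hm hf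
      obtain ⟨rfl, k3⟩ := k3 _ hctl
      obtain ⟨n, hn, rfl, hfed⟩ := hr
      obtain rfl := (k4 _ _ hfed).2 rfl
      exact ih ⟨k1, k3, k2 _ hc, .refl⟩ hs₁ (fun _ => (hb (by simp)).update hM hs hm hc
        (ℓ := .nop) trivial (hinp _) (hinp _)) h2 herr
    | @exec q q' x ℓ hout =>
      obtain ⟨-, k1, k2, k3, k4⟩ := ctlTemplate_fires hM hm hf
      obtain ⟨rfl, k3⟩ := k3 _ hctl
      have htrue : ℓ.Truthful st := by
        match hi : A.instr q, hout with
        | .push k y p, hout => cases hout; trivial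
        | .jump p, hout => cases hout; trivial
        | .read k drop f, hout =>
          cases hout
          by_contra hne
          obtain ⟨z, hz, hz'⟩ := exists_error_foldl hM ((hb (by simp)).exists_error (A := A)
            (w := w) hM hne) ((A.schema.problem M w).emitted s₁ π)
          exact herr z hz hz'
      have hreach : A.Reaches w (q', ℓ.effect st) := hr.tail (.mk hout htrue)
      exact ih ⟨k1, k3, k2 _ hc, hreach⟩ hs₁ (fun _ => (hb (by simp)).update hM hs hm hc
        htrue (hlen _ _ hr) (hlen _ _ hreach)) h2 herr
    | spawn _ => cases hback _ (modeTemplate_fires hM hm hf).2.1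
    | keep _ _ | clash _ _ | error _ => cases hback _ (modeTemplate_fires hM hm hf).2.1
    | up _ _ _ | down _ _ _ => cases hback _ (countTemplate_fires hM hm hf).2.1

/-- Legible plans exist exactly for the accepted inputs, if no stack gets too high to be counted. -/
theorem exists_isLegible_iff (hM : 0 < M) (hw : w.length ≤ M)
    (hlen : ∀ q st, A.Reaches w (q, st) → ∀ k, (st k).length < 2 ^ M) :
    (∃ π, (A.schema.problem M w).IsLegible 1 π) ↔ ∃ st, A.Reaches w (A.accept, st) := by
  constructor
  · rintro ⟨π, hπ⟩
    obtain ⟨⟨s', hrun, hgoal⟩, hleg⟩ := (COProblem.isLegible_one_iff _ _).1 hπ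
    refine reaches_of_run hM hw hlen π (represents_init)
      (b := (A.schema.problem M w).initBelief (A.schema.problem M w).init) rfl (by simp) hrun
      hgoal fun x hx hm => ?_
    refine hleg _ (List.mem_singleton.2 rfl) ?_ x hx ((sat_other_iff hM hm).2 rfl)
    intro he
    have := congrFun he (Schema.fluent (.mode .error) ⟨0, hM⟩)
    simp [Schema.problem, schema] at this
  · rintro ⟨st, hst⟩
    obtain ⟨s, ⟨π, hrun, hb⟩, h1, h2, -⟩ := attains_of_reaches hM hw hst
    refine ⟨π, (COProblem.isLegible_one_iff _ _).2 ⟨⟨s, hrun, ?_⟩, ?_⟩⟩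
    · exact (sat_goal_iff hM h1).2 ⟨rfl, fun i => (h2 _ i).2 rfl⟩
    · intro g hg _ x hx hsat
      obtain rfl := List.mem_singleton.1 hg
      rcases hb x hx with ⟨hm, -⟩ | ⟨k, g, h, hm, -⟩
      · cases (sat_other_iff hM hm).1 hsat
      · cases (sat_other_iff hM hm).1 hsat

end StackMachine

/-! ### From multi-stack Turing machines to stack machines -/

namespace FinTM2Sim

open Turing

variable (tm : FinTM2)

/-- The statements of the machine, and all their substatements. -/
def Sub : Type := {q : TM2.Stmt tm.Γ tm.Λ tm.σ // ∃ l, q ∈ TM2.stmts₁ (tm.m l)}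

instance : Finite (Sub tm) := by
  have := tm.ΛFin
  have h : {q : TM2.Stmt tm.Γ tm.Λ tm.σ | ∃ l, q ∈ TM2.stmts₁ (tm.m l)}.Finite := by
    have : {q : TM2.Stmt tm.Γ tm.Λ tm.σ | ∃ l, q ∈ TM2.stmts₁ (tm.m l)} =
        ⋃ l, (TM2.stmts₁ (tm.m l) : Set (TM2.Stmt tm.Γ tm.Λ tm.σ)) := by
      ext q
      simp
    rw [this]
    exact Set.finite_iUnion fun l => Finset.finite_toSet _
  exact h.to_subtype

/-- The symbols of the stack machine: an input symbol, or the statement and the internal state at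
the time when the symbol was pushed. They are finitely many, even if the alphabet of a stack is
infinite. -/
abbrev Sym : Type := tm.Γ tm.k₀ ⊕ Sub tm × tm.σ

/-- The control states of the stack machine: the statement that remains to be executed and the
internal state, or the verdict after the machine has halted. -/
abbrev Ctl : Type := (Sub tm × tm.σ) ⊕ Bool

noncomputable instance : Fintype (Sym tm) :=
  haveI := tm.Γk₀Fin
  haveI := tm.σFin
  Fintype.ofFinite _

noncomputable instance : Fintype (Ctl tm) :=
  haveI := tm.σFin
  Fintype.ofFinite _

variable {tm}

theorem Sub.of_mem {q q' : TM2.Stmt tm.Γ tm.Λ tm.σ} (h : ∃ l, q ∈ TM2.stmts₁ (tm.m l))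
    (hq : q' ∈ TM2.stmts₁ q) : ∃ l, q' ∈ TM2.stmts₁ (tm.m l) :=
  let ⟨l, hl⟩ := h
  ⟨l, TM2.stmts₁_trans hl hq⟩

/-- The symbol of the stack `k` that a symbol of the stack machine stands for. -/
def symbol (k : tm.K) : Sym tm → Option (tm.Γ k)
  | .inl a => if h : tm.k₀ = k then some (h ▸ a) else none
  | .inr (⟨.push k' f _, _⟩, v) => if h : k' = k then some (h ▸ f v) else none
  | .inr _ => none

open scoped Classical in
/-- The instructions of the stack machine; `yes` is the output symbol for acceptance. -/
noncomputable def instr (yes : tm.Γ tm.k₁) : Ctl tm → Instr tm.K (Sym tm) (Ctl tm)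
  | .inr _ => .halt
  | .inl (⟨.push k f q, h⟩, v) =>
    .push k (.inr (⟨.push k f q, h⟩, v))
      (.inl (⟨q, Sub.of_mem h (by simp [TM2.stmts₁, TM2.stmts₁_self])⟩, v))
  | .inl (⟨.peek k f q, h⟩, v) =>
    .read k false fun x =>
      .inl (⟨q, Sub.of_mem h (by simp [TM2.stmts₁, TM2.stmts₁_self])⟩, f v (x.bind (symbol k)))
  | .inl (⟨.pop k f q, h⟩, v) =>
    .read k true fun x =>
      .inl (⟨q, Sub.of_mem h (by simp [TM2.stmts₁, TM2.stmts₁_self])⟩, f v (x.bind (symbol k)))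
  | .inl (⟨.load a q, h⟩, v) =>
    .jump (.inl (⟨q, Sub.of_mem h (by simp [TM2.stmts₁, TM2.stmts₁_self])⟩, a v))
  | .inl (⟨.branch p q₁ q₂, h⟩, v) =>
    .jump (.inl (cond (p v)
      ⟨q₁, Sub.of_mem h (by simp [TM2.stmts₁, TM2.stmts₁_self])⟩
      ⟨q₂, Sub.of_mem h (by simp [TM2.stmts₁, TM2.stmts₁_self])⟩, v))
  | .inl (⟨.goto l, _⟩, v) => .jump (.inl (⟨tm.m (l v), l v, TM2.stmts₁_self⟩, v))
  | .inl (⟨.halt, _⟩, _) =>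
    .read tm.k₁ false fun x => .inr (decide (x.bind (symbol tm.k₁) = some yes))

/-- The stack machine that simulates `tm`. -/
noncomputable def machine (inp : Bool → tm.Γ tm.k₀) (yes : tm.Γ tm.k₁) :
    StackMachine tm.K (Sym tm) (Ctl tm) where
  instr := instr yes
  start := .inl (⟨tm.m tm.main, tm.main, TM2.stmts₁_self⟩, tm.initialState)
  accept := .inr true
  inStack := tm.k₀
  inSymbol b := .inl (inp b)

/-- The stacks of the stack machine stand for the stacks of the Turing machine. -/
def Agrees (st : tm.K → List (Sym tm)) (stk : ∀ k, List (tm.Γ k)) : Prop :=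
  ∀ k, (st k).map (symbol k) = (stk k).map some

namespace Agrees

variable {st : tm.K → List (Sym tm)} {stk : ∀ k, List (tm.Γ k)}

theorem length (h : Agrees st stk) (k : tm.K) : (st k).length = (stk k).length := by
  simpa using congrArg List.length (h k)

theorem head (h : Agrees st stk) (k : tm.K) : (st k).head?.bind (symbol k) = (stk k).head? := by
  have := congrArg List.head? (h k)
  rw [List.head?_map, List.head?_map] at this
  cases h1 : (st k).head? <;> cases h2 : (stk k).head? <;> simp_all

theorem push (h : Agrees st stk) {k : tm.K} {c : Sym tm} {x : tm.Γ k} (hc : symbol k c = some x) :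
    Agrees (Function.update st k (c :: st k)) (Function.update stk k (x :: stk k)) := by
  intro k'
  by_cases hk : k' = k
  · subst hk
    simp [hc, h k']
  · rw [Function.update_of_ne hk, Function.update_of_ne hk, h k']

theorem pop (h : Agrees st stk) (k : tm.K) :
    Agrees (Function.update st k (st k).tail) (Function.update stk k (stk k).tail) := by
  intro k'
  by_cases hk : k' = k
  · subst hk
    simp [List.map_tail, h k']
  · rw [Function.update_of_ne hk, Function.update_of_ne hk, h k']

end Agrees

variable (inp : Bool → tm.Γ tm.k₀) (yes : tm.Γ tm.k₁)

theorem agrees_input (w : List Bool) :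
    Agrees ((machine inp yes).inputStacks w) (initList tm (w.map inp)).stk := by
  intro k
  by_cases hk : k = tm.k₀
  · subst hk
    have h1 : (initList tm (w.map inp)).stk tm.k₀ = w.map inp := dif_pos rfl
    rw [h1]
    simp [StackMachine.inputStacks, machine, symbol, Function.comp_def]
  · have h1 : (initList tm (w.map inp)).stk k = [] := dif_neg hk
    have h2 : (machine inp yes).inputStacks w k = [] := Function.update_of_ne hk ..
    rw [h1, h2]
    rfl

open scoped Classical in
/-- The configuration `c` of the stack machine stands for the configuration `r` of the Turing
machine, at the start of a statement or after it has halted. -/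
def Simulates (c : Ctl tm × (tm.K → List (Sym tm))) (r : TM2.Cfg tm.Γ tm.Λ tm.σ) : Prop :=
  match r.l with
  | some l => c.1 = .inl (⟨tm.m l, l, TM2.stmts₁_self⟩, r.var) ∧ Agrees c.2 r.stk
  | none => c.1 = .inr (decide ((r.stk tm.k₁).head? = some yes))

/-- A whole statement, which is one step of the Turing machine, is executed instruction by
instruction. -/
theorem exists_simulates_stepAux (q : TM2.Stmt tm.Γ tm.Λ tm.σ)
    (h : ∃ l, q ∈ TM2.stmts₁ (tm.m l)) (v : tm.σ) {st : tm.K → List (Sym tm)}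
    {stk : ∀ k, List (tm.Γ k)} (hs : Agrees st stk) :
    ∃ c, Relation.ReflTransGen (machine inp yes).Step (.inl (⟨q, h⟩, v), st) c ∧
      Simulates yes c (TM2.stepAux q v stk) := by
  induction q generalizing v st stk with
  | push k f q ih =>
    obtain ⟨c, h1, h2⟩ := ih (Sub.of_mem h (by simp [TM2.stmts₁, TM2.stmts₁_self])) v
      (hs.push (c := .inr (⟨.push k f q, h⟩, v)) (x := f v) (by simp [symbol]))
    exact ⟨c, .head (.mk (x := none) rfl trivial) h1, h2⟩
  | peek k f q ih =>
    obtain ⟨c, h1, h2⟩ := ih (Sub.of_mem h (by simp [TM2.stmts₁, TM2.stmts₁_self]))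
      (f v (stk k).head?) hs
    rw [← hs.head k] at h1
    exact ⟨c, .head (.mk (x := (st k).head?) rfl rfl) h1, h2⟩
  | pop k f q ih =>
    obtain ⟨c, h1, h2⟩ := ih (Sub.of_mem h (by simp [TM2.stmts₁, TM2.stmts₁_self]))
      (f v (stk k).head?) (hs.pop k)
    rw [← hs.head k] at h1
    exact ⟨c, .head (.mk (x := (st k).head?) rfl rfl) h1, h2⟩
  | load a q ih =>
    obtain ⟨c, h1, h2⟩ := ih (Sub.of_mem h (by simp [TM2.stmts₁, TM2.stmts₁_self])) (a v) hs
    exact ⟨c, .head (.mk (x := none) rfl trivial) h1, h2⟩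
  | branch p q₁ q₂ ih₁ ih₂ =>
    cases hp : p v with
    | true =>
      obtain ⟨c, h1, h2⟩ := ih₁ (Sub.of_mem h (by simp [TM2.stmts₁, TM2.stmts₁_self])) v hs
      refine ⟨c, .head (.mk (x := none) (ℓ := .nop) ?_ trivial) h1, by simpa [hp] using h2⟩
      simp [machine, instr, Instr.out, hp]
      rfl
    | false =>
      obtain ⟨c, h1, h2⟩ := ih₂ (Sub.of_mem h (by simp [TM2.stmts₁, TM2.stmts₁_self])) v hs
      refine ⟨c, .head (.mk (x := none) (ℓ := .nop) ?_ trivial) h1, by simpa [hp] using h2⟩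
      simp [machine, instr, Instr.out, hp]
      rfl
  | goto l => exact ⟨_, .single (.mk (x := none) rfl trivial), rfl, hs⟩
  | halt =>
    refine ⟨_, .single (.mk (x := (st tm.k₁).head?) rfl rfl), ?_⟩
    simp only [Simulates, TM2.stepAux]
    rw [hs.head]
    rfl

theorem exists_simulates (w : List Bool) {r : tm.Cfg}
    (h : reachesFromInput tm (w.map inp) r) :
    ∃ c, (machine inp yes).Reaches w c ∧ Simulates yes c r := by
  induction h with
  | refl => exact ⟨_, .refl, rfl, agrees_input inp yes w⟩
  | @tail r r' _ hstep ih =>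
    obtain ⟨⟨c, st⟩, hc, hsim⟩ := ih
    obtain ⟨l, v, stk⟩ := r
    cases l with
    | none => cases hstep
    | some l =>
      obtain rfl : TM2.stepAux (tm.m l) v stk = r' := Option.some.inj hstep
      obtain ⟨rfl, hst⟩ := hsim
      obtain ⟨c, h1, h2⟩ := exists_simulates_stepAux inp yes (tm.m l) ⟨l, TM2.stmts₁_self⟩ v hst
      exact ⟨c, Relation.ReflTransGen.trans hc h1, h2⟩

/-- The greatest number of symbols that a statement can push. -/
def pushes : TM2.Stmt tm.Γ tm.Λ tm.σ → ℕ
  | .push _ _ q => pushes q + 1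
  | .peek _ _ q => pushes q
  | .pop _ _ q => pushes q
  | .load _ q => pushes q
  | .branch _ q₁ q₂ => max (pushes q₁) (pushes q₂)
  | .goto _ => 0
  | .halt => 0

variable (tm) in
/-- The greatest number of symbols that one step of the machine can push. -/
def maxPushes : ℕ :=
  letI := tm.ΛFin
  Finset.univ.sup fun l => pushes (tm.m l)

theorem pushes_le (l : tm.Λ) : pushes (tm.m l) ≤ maxPushes tm := by
  let := tm.ΛFin
  exact Finset.le_sup (f := fun l => pushes (tm.m l)) (Finset.mem_univ l)

theorem length_le_cfgSpace (c : tm.Cfg) (k : tm.K) :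
    (TM2.Cfg.stk c k).length ≤ cfgSpace tm c := by
  let := tm.kFin
  exact Finset.single_le_sum (f := fun k => (TM2.Cfg.stk c k).length) (fun _ _ => Nat.zero_le _)
    (Finset.mem_univ k)

open scoped Classical in
/-- What holds in every configuration of the stack machine that is reached on input `w`, if the
Turing machine uses at most `B` cells: the statement in execution leads to a configuration that the
Turing machine reaches, and its remaining pushes do not exceed the space that is left; after
halting, the verdict is right. -/
def Invariant (w : List Bool) (B : ℕ) (c : Ctl tm × (tm.K → List (Sym tm))) : Prop :=
  match c.1 with
  | .inl (q, v) => ∃ stk, Agrees c.2 stk ∧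
      reachesFromInput tm (w.map inp) (TM2.stepAux q.1 v stk) ∧
        ∀ k, (stk k).length + pushes q.1 ≤ B + maxPushes tm
  | .inr b => (∀ k, (c.2 k).length ≤ B + maxPushes tm) ∧ ∃ r : tm.Cfg,
      reachesFromInput tm (w.map inp) r ∧ TM2.Cfg.l r = none ∧
        b = decide ((TM2.Cfg.stk r tm.k₁).head? = some yes)

theorem invariant (w : List Bool) (B : ℕ)
    (hB : ∀ r : tm.Cfg, reachesFromInput tm (w.map inp) r → cfgSpace tm r ≤ B)
    {c : Ctl tm × (tm.K → List (Sym tm))} (hc : (machine inp yes).Reaches w c) :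
    Invariant inp yes w B c := by
  induction hc with
  | refl =>
    refine ⟨_, agrees_input inp yes w, Relation.ReflTransGen.single rfl, fun k => ?_⟩
    exact Nat.add_le_add ((length_le_cfgSpace _ k).trans (hB _ .refl)) (pushes_le _)
  | tail hr hstep ih =>
    cases hstep with
    | @mk q₀ q' x ℓ st hout htrue =>
      rcases q₀ with ⟨⟨q, hq⟩, v⟩ | b
      · obtain ⟨stk, hs, hreach, hlen⟩ := ih
        have hx : ∀ {k : tm.K}, (st k).head? = x → x.bind (symbol k) = (stk k).head? :=
          fun h => h ▸ hs.head _
        cases q with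
        | push k f q =>
          cases hout
          refine ⟨_, hs.push (x := f v) (by simp [symbol]), hreach, fun k' => ?_⟩
          have hk' : (Function.update stk k (f v :: stk k) k').length ≤ (stk k').length + 1 := by
            by_cases hk : k' = k
            · subst hk
              simp
            · rw [Function.update_of_ne hk]
              omega
          have := hlen k'
          simp only [pushes] at this ⊢
          omega
        | peek k f q =>
          cases hout
          refine ⟨stk, hs, ?_, hlen⟩
          rw [hx htrue]
          exact hreach
        | pop k f q =>
          cases hout
          refine ⟨_, hs.pop k, ?_, fun k' => ?_⟩
          · rw [hx htrue]
            exact hreach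
          · have hk' : (Function.update stk k (stk k).tail k').length ≤ (stk k').length := by
              by_cases hk : k' = k
              · subst hk
                simp
              · rw [Function.update_of_ne hk]
            exact (Nat.add_le_add_right hk' _).trans (hlen k')
        | load a q =>
          cases hout
          exact ⟨stk, hs, hreach, hlen⟩
        | branch p q₁ q₂ =>
          cases hout
          refine ⟨stk, hs, ?_, fun k => ?_⟩
          · simp only [TM2.stepAux] at hreach
            cases hp : p v <;> rw [hp] at hreach <;> exact hreach
          · have := hlen k
            simp only [pushes] at this
            cases hp : p v <;> simp only [cond] <;> omega
        | goto l =>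
          cases hout
          refine ⟨stk, hs, Relation.ReflTransGen.tail hreach rfl, fun k => ?_⟩
          exact Nat.add_le_add ((length_le_cfgSpace _ k).trans (hB _ hreach)) (pushes_le _)
        | halt =>
          cases hout
          refine ⟨fun k => ?_, _, hreach, rfl, ?_⟩
          · have := hlen k
            rw [← hs.length k] at this
            exact (Nat.le_add_right _ _).trans this
          · rw [hx htrue]
            rfl
      · cases hout

theorem length_le_of_reaches (w : List Bool) (B : ℕ)
    (hB : ∀ r : tm.Cfg, reachesFromInput tm (w.map inp) r → cfgSpace tm r ≤ B)
    {q : Ctl tm} {st : tm.K → List (Sym tm)} (hc : (machine inp yes).Reaches w (q, st)) (k : tm.K) :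
    (st k).length ≤ B + maxPushes tm := by
  have h := invariant inp yes w B hB hc
  rcases q with ⟨q, v⟩ | b
  · obtain ⟨stk, hs, -, hlen⟩ := h
    rw [hs.length k]
    exact (Nat.le_add_right _ _).trans (hlen k)
  · exact h.1 k

open scoped Classical in
/-- A machine that halts with the one-symbol output `o` is simulated by a stack machine that accepts
exactly if `o` is `yes`. -/
theorem accepts_iff (w : List Bool) (B : ℕ)
    (hB : ∀ r : tm.Cfg, reachesFromInput tm (w.map inp) r → cfgSpace tm r ≤ B)
    {o : tm.Γ tm.k₁} (ho : TM2Outputs tm (w.map inp) (some [o])) :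
    (∃ st, (machine inp yes).Reaches w ((machine inp yes).accept, st)) ↔ o = yes := by
  have hreach : reachesFromInput tm (w.map inp) (haltList tm [o]) := by
    obtain ⟨n, hn⟩ := ho
    have key : ∀ n (a b : tm.Cfg), (flip bind tm.step)^[n] (some a) = some b →
        TM2.Reaches tm.m a b := by
      intro n
      induction n with
      | zero =>
        intro a b h
        obtain rfl : a = b := Option.some.inj h
        exact .refl
      | succ n ih =>
        intro a b h
        rw [Function.iterate_succ_apply] at h
        cases ha : tm.step a with
        | none =>
          have hnone : ∀ m, (flip bind tm.step)^[m] none = none := by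
            intro m
            induction m with
            | zero => rfl
            | succ m ihm => rw [Function.iterate_succ_apply]; exact ihm
          have : flip bind tm.step (some a) = none := ha
          rw [this, hnone] at h
          cases h
        | some a' =>
          have : flip bind tm.step (some a) = some a' := ha
          rw [this] at h
          exact .head ha (ih a' b h)
    exact key n _ _ hn
  have hstk : TM2.Cfg.stk (haltList tm [o]) tm.k₁ = [o] := dif_pos rfl
  constructor
  · rintro ⟨st, hst⟩
    obtain ⟨-, r, hr, hl, hb⟩ := invariant inp yes w B hB hst
    have hterm : ∀ r r' : tm.Cfg, TM2.Cfg.l r = none → TM2.Reaches tm.m r r' → r = r' := by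
      rintro ⟨l, v, stk⟩ r' hl hrr'
      cases hrr'.cases_head with
      | inl h => exact h
      | inr h =>
        obtain ⟨c, hc, -⟩ := h
        obtain rfl : l = none := hl
        cases hc
    have heq : r = haltList tm [o] := by
      have huniq : Relator.RightUnique fun a b : TM2.Cfg tm.Γ tm.Λ tm.σ => b ∈ TM2.step tm.m a :=
        fun a b c hb hc => Option.some.inj (hb.symm.trans hc)
      rcases Relation.ReflTransGen.total_of_right_unique huniq hr hreach with h | h
      · exact hterm _ _ hl h
      · exact (hterm _ _ rfl h).symm
    rw [heq, hstk] at hb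
    exact Option.some.inj (of_decide_eq_true hb.symm)
  · rintro rfl
    obtain ⟨⟨c, st⟩, hc, hsim⟩ := exists_simulates inp o w hreach
    have hs : c = .inr (decide ((TM2.Cfg.stk (haltList tm [o]) tm.k₁).head? = some o)) := hsim
    rw [hstk] at hs
    refine ⟨st, ?_⟩
    rw [hs] at hc
    simpa [machine] using hc

end FinTM2Sim

/-! ### The reduction -/

/-- Every polynomial is below a power of a shift of the identity. -/
theorem Polynomial.exists_eval_le_pow (p : Polynomial ℕ) :
    ∃ a D, 1 ≤ a ∧ 1 ≤ D ∧ ∀ n : ℕ, p.eval n ≤ (n + a) ^ D := by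
  induction p using Polynomial.induction_on' with
  | add p q hp hq =>
    obtain ⟨a, D, ha, hD, hp⟩ := hp
    obtain ⟨b, E, hb, hE, hq⟩ := hq
    refine ⟨a + b + 1, max D E + 1, by omega, by omega, fun n => ?_⟩
    have h1 : (n + a) ^ D ≤ (n + (a + b + 1)) ^ max D E :=
      (Nat.pow_le_pow_left (by omega) D).trans (Nat.pow_le_pow_right (by omega) (le_max_left D E))
    have h2 : (n + b) ^ E ≤ (n + (a + b + 1)) ^ max D E :=
      (Nat.pow_le_pow_left (by omega) E).trans (Nat.pow_le_pow_right (by omega) (le_max_right D E))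
    calc (p + q).eval n = p.eval n + q.eval n := Polynomial.eval_add
      _ ≤ (n + (a + b + 1)) ^ max D E * 2 := by have := hp n; have := hq n; omega
      _ ≤ (n + (a + b + 1)) ^ max D E * (n + (a + b + 1)) := Nat.mul_le_mul_left _ (by omega)
      _ = (n + (a + b + 1)) ^ (max D E + 1) := (pow_succ _ _).symm
  | monomial k c =>
    refine ⟨c + 1, k + 1, by omega, by omega, fun n => ?_⟩
    rw [Polynomial.eval_monomial, pow_succ, mul_comm]
    exact Nat.mul_le_mul (Nat.pow_le_pow_left (by omega) k) (by omega)

/-- Every language of exponential space reduces to the question whether the problems of some schema,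
on a number of copies that is polynomial in the length of the input, have a legible plan. -/
theorem InEXPSPACE.exists_schema {L : Set (List Bool)} (hL : InEXPSPACE L) :
    ∃ (Φ Λ : Type) (_ : Fintype Φ) (_ : Fintype Λ) (S : Schema Φ Λ) (a D : ℕ), 1 ≤ a ∧ 1 ≤ D ∧
      ∀ w : List Bool, w ∈ L ↔ ∃ π, (S.problem ((w.length + a) ^ D) w).IsLegible 1 π := by
  obtain ⟨M, p, hB⟩ := hL
  have := M.tm.kFin
  obtain ⟨a, D, ha, hD, hp⟩ :=
    (p + Polynomial.C (FinTM2Sim.maxPushes M.tm + 1)).exists_eval_le_pow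
  refine ⟨_, _, inferInstance, inferInstance,
    (FinTM2Sim.machine M.inputAlphabet.invFun (M.outputAlphabet.invFun true)).schema,
    a, D, ha, hD, fun w => ?_⟩
  have hsize : p.eval w.length + (FinTM2Sim.maxPushes M.tm + 1) ≤ (w.length + a) ^ D := by
    simpa using hp w.length
  -- The stacks have at most `2 ^ p + maxPushes` symbols, and `2 ^ p + m < 2 ^ (p + m + 1)`.
  have hspace : 2 ^ p.eval w.length + FinTM2Sim.maxPushes M.tm < 2 ^ (w.length + a) ^ D := by
    refine lt_of_lt_of_le ?_ (Nat.pow_le_pow_right (by norm_num) hsize)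
    generalize FinTM2Sim.maxPushes M.tm = m
    have h1 : m + 1 < 2 ^ (m + 1) := Nat.lt_two_pow_self
    have h2 : 1 ≤ 2 ^ p.eval w.length := Nat.one_le_two_pow
    rw [pow_add]
    nlinarith
  rw [StackMachine.exists_isLegible_iff (by omega)
    ((Nat.le_add_right _ a).trans (Nat.le_self_pow (by omega) _))
    fun q st hq k => (FinTM2Sim.length_le_of_reaches _ _ w _ (hB w) hq k).trans_lt hspace,
    FinTM2Sim.accepts_iff _ _ w _ (hB w) (M.outputsFun w)]
  have hL : w ∈ L ↔ charFun L w = true := by simp [charFun]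
  exact hL.trans M.outputAlphabet.symm.injective.eq_iff.symm

/-- Plan existence for controlled observability planning is `EXPSPACE`-hard; and it is so already
for `k = j = 1`, that is, for the question whether there is a plan that is both 1-ambiguous and
1-legible (exactly one candidate goal is possible in the last belief). -/
theorem theorem1 :
    EXPSPACEHard encInstance {q : COInstance | q.HasSolution} ∧
    EXPSPACEHard encProblem
      {P : COProblem | ∃ π, P.IsAmbiguous 1 π ∧ P.IsLegible 1 π} := by
  constructor <;> intro L hL <;> obtain ⟨Φ, Λ, _, _, S, a, D, ha, hD, h⟩ := hL.exists_schema
  · exact ⟨fun w => ⟨.legibility, 1, S.problem ((w.length + a) ^ D) w⟩,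
      S.computable ha hD [true, true, false] fun w => rfl, h⟩
  · refine ⟨fun w => S.problem ((w.length + a) ^ D) w, S.computable ha hD [] fun w => rfl,
      fun w => (h w).trans ?_⟩
    exact exists_congr fun π => ⟨fun hπ => ⟨hπ.isAmbiguous, hπ⟩, fun hπ => hπ.2⟩
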